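/- Let $\mathbb F$ be a field. "Algebra" means associative, not necessarily commutative or unital $\mathbb F$-algebra, and tensor products are over $\mathbb F$. An elementary homotopy from $f:A\to B$ to $g:A\to B$ is a homomorphism $H:A\to B[x]=B\otimes\mathbb F[x]$ with $\mathrm{ev}_0H=f$ and $\mathrm{ev}_1H=g$; two homomorphisms are homotopic if they are joined by a finite chain of elementary homotopies. $\mathrm{Hot}(\mathrm{Alg})$ is the category of algebras and homotopy classes of homomorphisms. A pro-object of a category is an inverse system indexed by a nonempty directed set, with $\mathrm{Hom}((C_i)_i,(D_j)_j)=\varprojlim_j\varinjlim_i\mathrm{Hom}(C_i,D_j)$; objects are viewed as constant pro-objects. A pro-algebra is a pro-object of the category of algebras; it is also regarded as an object of $\text{pro-}\mathrm{Hot}(\mathrm{Alg})$. For a pro-algebra $P$ and an algebra $B$, $[P,B]$ denotes the set of morphisms $P\to B$ in $\text{pro-}\mathrm{Hot}(\mathrm{Alg})$. The category $\text{pro-}\mathrm{Hot}(\mathrm{Alg})$ has finite coproducts, so one can speak of cocommutative cogroup structures on its objects; such a structure on $P$ makes $[P,B]$ an abelian group, functorially in $B$. Let $M_n(B)=M_n(\mathbb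 F)\otimes B$, and let $M_\bullet(B)=M_\bullet(\mathbb F)\otimes B$ be the ind-algebra $(M_n(B))_{n}$ with the upper left corner embeddings. Let $qA$ be the kernel of the codiagonal $A\star A\to A$ of the free product. Put $\mathfrak{QQ}(A,B)=[qA,M_\bullet(B)]=\varinjlim_n\mathrm{Hom}_{\mathrm{Hot}(\mathrm{Alg})}(qA,M_n(B))$. This is an abelian group, functorial in $B$: the sum of the classes of $\alpha:qA\to M_m(B)$ and $\beta:qA\to M_n(B)$ is the class of the block sum $\alpha\oplus\beta:qA\to M_{m+n}(B)$, the zero element is the class of the zero homomorphism, and the negative is given by composition with the switch of $qA$. Put $\mathfrak Q(B)=\mathfrak{QQ}(\mathbb F,B)$. **Theorem.** For each algebra $A$ there is a pro-algebra $\overline{\mathfrak{QQ}}_A=\mathfrak M^{nc}(qA,M_\bullet(\mathbb F))$ that represents the functor $C\mapsto \mathrm{Hom}(qA,M_\bullet(\mathbb F)\otimes C)=\varinjlim_n\mathrm{Hom}(qA,M_n(C))$ on algebras, i.e. that comes with bijections $\Phi_C:\mathrm{Hom}_{\text{pro-Alg}}(\overline{\mathfrak{QQ}}_A,C)\to\varinjlim_n\mathrm{Hom}(qA,M_n(C))$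 natural in the algebra $C$. For every pro-algebra $\overline{\mathfrak{QQ}}_A$ with such a representation $\Phi$ there are a cocommutative cogroup structure on $\overline{\mathfrak{QQ}}_A$ as an object of $\text{pro-}\mathrm{Hot}(\mathrm{Alg})$ and isomorphisms of abelian groups $$[\overline{\mathfrak{QQ}}_A,B]\cong\mathfrak{QQ}(A,B),$$ natural in the algebra $B$, that send the class of a morphism $\varphi:\overline{\mathfrak{QQ}}_A\to B$ to the class of $\Phi_B(\varphi)$. In particular, there is a pro-algebra $\overline{\mathfrak Q}$ with a cocommutative cogroup structure in $\text{pro-}\mathrm{Hot}(\mathrm{Alg})$ and isomorphisms of abelian groups $[\overline{\mathfrak Q},B]\cong\mathfrak Q(B)$, natural in the algebra $B$. -/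

import Mathlib

open CategoryTheory CategoryTheory.Limits
open scoped TensorProduct Polynomial

noncomputable section

universe u v w

set_option linter.unusedSectionVars false

namespace ClassifyingPro

/-! ### Nonunital algebras: tensor products, polynomial extensions, homotopy -/

section Algebras

variable {F : Type*} [Field F]
variable {A A' B B' C : Type*}
variable [NonUnitalRing A] [Module F A] [IsScalarTower F A A] [SMulCommClass F A A]
variable [NonUnitalRing A'] [Module F A'] [IsScalarTower F A' A'] [SMulCommClass F A' A']
variable [NonUnitalRing B] [Module F B] [IsScalarTower F B B] [SMulCommClass F B B]
variable [NonUnitalRing B'] [Module F B'] [IsScalarTower F B' B'] [SMulCommClass F B' B']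
variable [NonUnitalRing C] [Module F C] [IsScalarTower F C C] [SMulCommClass F C C]

/-- A linear map that is multiplicative, as a morphism of nonunital algebras. -/
def ofLinear (f : A →ₗ[F] B) (h : ∀ x y, f (x * y) = f x * f y) : A →ₙₐ[F] B where
  toFun := f
  map_smul' := f.map_smul
  map_zero' := f.map_zero
  map_add' := f.map_add
  map_mul' := h

@[simp] theorem ofLinear_apply (f : A →ₗ[F] B) (h : ∀ x y, f (x * y) = f x * f y) (x : A) :
    ofLinear f h x = f x := rfl

/-- A linear map on a tensor product which is multiplicative on pure tensors. -/
def ofTensor (f : A ⊗[F] B →ₗ[F] C)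
    (h : ∀ a a' b b', f ((a * a') ⊗ₜ (b * b')) = f (a ⊗ₜ b) * f (a' ⊗ₜ b')) :
    A ⊗[F] B →ₙₐ[F] C :=
  ofLinear f (by
    intro x y
    induction x with
    | zero => simp
    | add x x' hx hx' => simp [add_mul, hx, hx']
    | tmul a b =>
      induction y with
      | zero => simp
      | add y y' hy hy' => simp [mul_add, hy, hy']
      | tmul a' b' => simpa using h a a' b b')

@[simp] theorem ofTensor_apply (f : A ⊗[F] B →ₗ[F] C)
    (h : ∀ a a' b b', f ((a * a') ⊗ₜ (b * b')) = f (a ⊗ₜ b) * f (a' ⊗ₜ b')) (x : A ⊗[F] B) :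
    ofTensor f h x = f x := rfl

theorem tensor_hom_ext {f g : A ⊗[F] B →ₙₐ[F] C} (h : ∀ a b, f (a ⊗ₜ b) = g (a ⊗ₜ b)) : f = g := by
  ext x
  induction x with
  | zero => simp
  | add x y hx hy => simp [hx, hy]
  | tmul a b => exact h a b

/-- The tensor product `f ⊗ g : A ⊗ B → A' ⊗ B'` of two morphisms of algebras. -/
def tmap (f : A →ₙₐ[F] A') (g : B →ₙₐ[F] B') : A ⊗[F] B →ₙₐ[F] A' ⊗[F] B' :=
  ofTensor (TensorProduct.map (f : A →ₗ[F] A') (g : B →ₗ[F] B')) (by simp)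

@[simp] theorem tmap_tmul (f : A →ₙₐ[F] A') (g : B →ₙₐ[F] B') (a : A) (b : B) :
    tmap f g (a ⊗ₜ b) = f a ⊗ₜ g b := rfl

/-- The associativity isomorphism of the tensor product. -/
def assocHom : (A ⊗[F] B) ⊗[F] C →ₙₐ[F] A ⊗[F] (B ⊗[F] C) :=
  ofTensor (F := F) (A := A ⊗[F] B) (B := C) (C := A ⊗[F] (B ⊗[F] C))
    (TensorProduct.assoc F A B C).toLinearMap (by
    intro x x' c c'
    induction x with
    | zero => simp
    | add x y hx hy => rw [add_mul, TensorProduct.add_tmul, TensorProduct.add_tmul, map_add, map_add,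
        hx, hy, add_mul]
    | tmul a b =>
      induction x' with
      | zero => simp
      | add x y hx hy => rw [mul_add, TensorProduct.add_tmul, TensorProduct.add_tmul, map_add, map_add,
          hx, hy, mul_add]
      | tmul a' b' => simp)

@[simp] theorem assocHom_tmul (a : A) (b : B) (c : C) :
    assocHom ((a ⊗ₜ[F] b) ⊗ₜ[F] c) = a ⊗ₜ (b ⊗ₜ c) := rfl

/-- The inverse of the associativity isomorphism. -/
def assocInvHom : A ⊗[F] (B ⊗[F] C) →ₙₐ[F] (A ⊗[F] B) ⊗[F] C :=
  ofTensor (F := F) (A := A) (B := B ⊗[F] C) (C := (A ⊗[F] B) ⊗[F] C)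
    (TensorProduct.assoc F A B C).symm.toLinearMap (by
    intro a a' x x'
    induction x with
    | zero => simp
    | add x y hx hy => rw [add_mul, TensorProduct.tmul_add, TensorProduct.tmul_add, map_add, map_add,
        hx, hy, add_mul]
    | tmul b c =>
      induction x' with
      | zero => simp
      | add x y hx hy => rw [mul_add, TensorProduct.tmul_add, TensorProduct.tmul_add, map_add, map_add,
          hx, hy, mul_add]
      | tmul b' c' => simp)

@[simp] theorem assocInvHom_tmul (a : A) (b : B) (c : C) :
    assocInvHom (a ⊗ₜ[F] (b ⊗ₜ[F] c)) = (a ⊗ₜ b) ⊗ₜ c := rfl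

/-- The commutativity isomorphism of the tensor product. -/
def commHom : A ⊗[F] B →ₙₐ[F] B ⊗[F] A :=
  ofTensor (TensorProduct.comm F A B).toLinearMap (by simp)

@[simp] theorem commHom_tmul (a : A) (b : B) : commHom (a ⊗ₜ[F] b) = b ⊗ₜ a := rfl

/-- The polynomial extension `B[x]` is `B ⊗ F[x]`; this is the evaluation `B[x] → B`, `x ↦ t`. -/
def evalAt (t : F) : B ⊗[F] F[X] →ₙₐ[F] B :=
  ofTensor (TensorProduct.lift ((LinearMap.lsmul F B).flip.compl₂ (Polynomial.leval t))) (by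
    intro a a' p p'
    simp [smul_mul_smul_comm])

@[simp] theorem evalAt_tmul (t : F) (b : B) (p : F[X]) :
    evalAt t (b ⊗ₜ[F] p) = p.eval t • b := by
  simp [evalAt]

/-- `f ≈ g`: there is an elementary homotopy `H : A → B[x]` from `f` to `g`. -/
def ElemHomotopic (f g : A →ₙₐ[F] B) : Prop :=
  ∃ H : A →ₙₐ[F] B ⊗[F] F[X], (evalAt 0).comp H = f ∧ (evalAt 1).comp H = g

/-- Algebraic homotopy: a finite chain of elementary homotopies. -/
def Homotopic (f g : A →ₙₐ[F] B) : Prop :=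
  Relation.ReflTransGen ElemHomotopic f g

theorem ElemHomotopic.symm {f g : A →ₙₐ[F] B} (h : ElemHomotopic f g) : ElemHomotopic g f := by
  obtain ⟨H, rfl, rfl⟩ := h
  let r : F[X] →ₙₐ[F] F[X] := (Polynomial.aeval (1 - Polynomial.X : F[X]) : F[X] →ₐ[F] F[X])
  have key : ∀ t : F, (evalAt t).comp (tmap (NonUnitalAlgHom.id F B) r) = evalAt (1 - t) := by
    intro t
    refine tensor_hom_ext fun b p => ?_
    have : (r p).eval t = p.eval (1 - t) := by
      change (Polynomial.aeval (1 - Polynomial.X : F[X]) p).eval t = _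
      rw [← Polynomial.comp_eq_aeval, Polynomial.eval_comp]
      simp
    simp [this]
  refine ⟨(tmap (NonUnitalAlgHom.id F B) r).comp H, ?_, ?_⟩
  · ext a
    have := NonUnitalAlgHom.congr_fun (key 0) (H a)
    simpa using this
  · ext a
    have := NonUnitalAlgHom.congr_fun (key 1) (H a)
    simpa using this

theorem ElemHomotopic.comp_right {f g : A →ₙₐ[F] B} (h : ElemHomotopic f g) (k : C →ₙₐ[F] A) :
    ElemHomotopic (f.comp k) (g.comp k) := by
  obtain ⟨H, rfl, rfl⟩ := h
  exact ⟨H.comp k, rfl, rfl⟩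

theorem evalAt_tmap (k : B →ₙₐ[F] C) (t : F) (x : B ⊗[F] F[X]) :
    evalAt t (tmap k (NonUnitalAlgHom.id F F[X]) x) = k (evalAt t x) := by
  have : (evalAt t).comp (tmap k (NonUnitalAlgHom.id F F[X])) = k.comp (evalAt t) :=
    tensor_hom_ext fun b p => by simp
  exact NonUnitalAlgHom.congr_fun this x

theorem ElemHomotopic.comp_left {f g : A →ₙₐ[F] B} (h : ElemHomotopic f g) (k : B →ₙₐ[F] C) :
    ElemHomotopic (k.comp f) (k.comp g) := by
  obtain ⟨H, rfl, rfl⟩ := h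
  exact ⟨(tmap k (NonUnitalAlgHom.id F F[X])).comp H, by ext a; simp [evalAt_tmap],
    by ext a; simp [evalAt_tmap]⟩

/-- The canonical embedding `B → B[x]`. -/
def constHom : B →ₙₐ[F] B ⊗[F] F[X] :=
  ofLinear ((TensorProduct.mk F B F[X]).flip 1) (by simp)

@[simp] theorem constHom_apply (b : B) : (constHom b : B ⊗[F] F[X]) = b ⊗ₜ 1 := rfl

theorem ElemHomotopic.refl (f : A →ₙₐ[F] B) : ElemHomotopic f f :=
  ⟨constHom.comp f, by ext; simp, by ext; simp⟩

theorem Homotopic.symm {f g : A →ₙₐ[F] B} (h : Homotopic f g) : Homotopic g f :=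
  haveI : Std.Symm (ElemHomotopic (F := F) (A := A) (B := B)) := ⟨fun _ _ => ElemHomotopic.symm⟩
  Relation.ReflTransGen.stdSymm.symm _ _ h

theorem Homotopic.comp_right {f g : A →ₙₐ[F] B} (h : Homotopic f g) (k : C →ₙₐ[F] A) :
    Homotopic (f.comp k) (g.comp k) :=
  Relation.ReflTransGen.lift (fun f : A →ₙₐ[F] B => f.comp k) (fun _ _ h => h.comp_right k) _ _ h

theorem Homotopic.comp_left {f g : A →ₙₐ[F] B} (h : Homotopic f g) (k : B →ₙₐ[F] C) :
    Homotopic (k.comp f) (k.comp g) :=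
  Relation.ReflTransGen.lift (fun f : A →ₙₐ[F] B => k.comp f) (fun _ _ h => h.comp_left k) _ _ h

/-- The sum of two morphisms with mutually annihilating images. -/
def orthSum (f g : A →ₙₐ[F] B) (h : ∀ a b, f a * g b = 0 ∧ g a * f b = 0) : A →ₙₐ[F] B :=
  ofLinear ((f : A →ₗ[F] B) + (g : A →ₗ[F] B)) (by
    intro x y
    simp [add_mul, mul_add, (h _ _).1, (h _ _).2])

@[simp] theorem orthSum_apply (f g : A →ₙₐ[F] B) (h : ∀ a b, f a * g b = 0 ∧ g a * f b = 0)
    (a : A) : orthSum f g h a = f a + g a := rfl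

theorem tmap_mul_tmap_eq_zero {f : A →ₙₐ[F] A'} {g : C →ₙₐ[F] A'} (h : ∀ a c, f a * g c = 0)
    (k l : B →ₙₐ[F] B') (x : A ⊗[F] B) (y : C ⊗[F] B) : tmap f k x * tmap g l y = 0 := by
  induction x with
  | zero => simp
  | add x x' hx hx' => simp [add_mul, hx, hx']
  | tmul a b =>
    induction y with
    | zero => simp
    | add y y' hy hy' => rw [map_add, mul_add, hy, hy', add_zero]
    | tmul a' b' => simp [h]

theorem ElemHomotopic.prod {f f' : A →ₙₐ[F] B} {g g' : A →ₙₐ[F] C} (hf : ElemHomotopic f f')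
    (hg : ElemHomotopic g g') : ElemHomotopic (f.prod g) (f'.prod g') := by
  obtain ⟨H, rfl, rfl⟩ := hf
  obtain ⟨K, rfl, rfl⟩ := hg
  refine ⟨orthSum ((tmap (NonUnitalAlgHom.inl F B C) (NonUnitalAlgHom.id F F[X])).comp H)
    ((tmap (NonUnitalAlgHom.inr F B C) (NonUnitalAlgHom.id F F[X])).comp K)
    fun a b => ⟨?_, ?_⟩, ?_, ?_⟩
  · exact tmap_mul_tmap_eq_zero (fun x y => by ext <;> simp) _ _ _ _
  · exact tmap_mul_tmap_eq_zero (fun x y => by ext <;> simp) _ _ _ _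
  · ext a <;> simp [evalAt_tmap]
  · ext a <;> simp [evalAt_tmap]

theorem Homotopic.prod {f f' : A →ₙₐ[F] B} {g g' : A →ₙₐ[F] C} (hf : Homotopic f f')
    (hg : Homotopic g g') : Homotopic (f.prod g) (f'.prod g') :=
  (Relation.ReflTransGen.lift (fun f : A →ₙₐ[F] B => f.prod g)
    (fun _ _ h => h.prod (ElemHomotopic.refl g)) _ _ hf).trans
  (Relation.ReflTransGen.lift (fun g : A →ₙₐ[F] C => f'.prod g)
    (fun _ _ h => (ElemHomotopic.refl f').prod h) _ _ hg)

end Algebras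

/-! ### Free products -/

section FreeProduct

variable (F : Type*) [Field F]
variable (A B : Type*) {C : Type*}
variable [NonUnitalRing A] [Module F A] [IsScalarTower F A A] [SMulCommClass F A A]
variable [NonUnitalRing B] [Module F B] [IsScalarTower F B B] [SMulCommClass F B B]
variable [NonUnitalRing C] [Module F C] [IsScalarTower F C C] [SMulCommClass F C C]

/-- The relations making the two families of generators of the free product
into morphisms of algebras. -/
inductive FreeProdRel : FreeAlgebra F (A ⊕ B) → FreeAlgebra F (A ⊕ B) → Prop
  | add_left (a a' : A) : FreeProdRel (FreeAlgebra.ι F (Sum.inl (a + a')))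
      (FreeAlgebra.ι F (Sum.inl a) + FreeAlgebra.ι F (Sum.inl a'))
  | smul_left (t : F) (a : A) : FreeProdRel (FreeAlgebra.ι F (Sum.inl (t • a)))
      (t • FreeAlgebra.ι F (Sum.inl a))
  | mul_left (a a' : A) : FreeProdRel (FreeAlgebra.ι F (Sum.inl (a * a')))
      (FreeAlgebra.ι F (Sum.inl a) * FreeAlgebra.ι F (Sum.inl a'))
  | add_right (b b' : B) : FreeProdRel (FreeAlgebra.ι F (Sum.inr (b + b')))
      (FreeAlgebra.ι F (Sum.inr b) + FreeAlgebra.ι F (Sum.inr b'))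
  | smul_right (t : F) (b : B) : FreeProdRel (FreeAlgebra.ι F (Sum.inr (t • b)))
      (t • FreeAlgebra.ι F (Sum.inr b))
  | mul_right (b b' : B) : FreeProdRel (FreeAlgebra.ι F (Sum.inr (b * b')))
      (FreeAlgebra.ι F (Sum.inr b) * FreeAlgebra.ι F (Sum.inr b'))

/-- The generators of the free product inside its unital envelope. -/
def freeProdGen (x : A ⊕ B) : RingQuot (FreeProdRel F A B) :=
  RingQuot.mkAlgHom F (FreeProdRel F A B) (FreeAlgebra.ι F x)

/-- The nonunital subalgebra generated by the generators. -/
abbrev FreeProdSub : NonUnitalSubalgebra F (RingQuot (FreeProdRel F A B)) :=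
  NonUnitalAlgebra.adjoin F (Set.range (freeProdGen F A B))

/-- The free product (coproduct of nonunital algebras) `A ⋆ B`: the nonunital algebra generated by
copies of `A` and `B`. -/
def FreeProd : Type _ := FreeProdSub F A B

instance : NonUnitalRing (FreeProd F A B) := inferInstanceAs (NonUnitalRing (FreeProdSub F A B))
instance : Module F (FreeProd F A B) := inferInstanceAs (Module F (FreeProdSub F A B))
instance : IsScalarTower F (FreeProd F A B) (FreeProd F A B) :=
  inferInstanceAs (IsScalarTower F (FreeProdSub F A B) (FreeProdSub F A B))
instance : SMulCommClass F (FreeProd F A B) (FreeProd F A B) :=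
  inferInstanceAs (SMulCommClass F (FreeProdSub F A B) (FreeProdSub F A B))

/-- The inclusion of `A ⋆ B` into its unital envelope. -/
def FreeProd.val : FreeProd F A B →ₙₐ[F] RingQuot (FreeProdRel F A B) where
  toFun x := Subtype.val x
  map_smul' _ _ := rfl
  map_zero' := rfl
  map_add' _ _ := rfl
  map_mul' _ _ := rfl

variable {A B} in
theorem FreeProd.val_injective : Function.Injective (FreeProd.val F A B) := Subtype.val_injective

variable {A B} in
theorem FreeProd.val_mem (x : FreeProd F A B) : FreeProd.val F A B x ∈ FreeProdSub F A B := x.2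

variable {A B}

theorem freeProdGen_add_left (a a' : A) : freeProdGen F A B (Sum.inl (a + a')) =
    freeProdGen F A B (Sum.inl a) + freeProdGen F A B (Sum.inl a') := by
  simpa [freeProdGen] using RingQuot.mkAlgHom_rel F (FreeProdRel.add_left (A := A) (B := B) a a')

theorem freeProdGen_smul_left (t : F) (a : A) : freeProdGen F A B (Sum.inl (t • a)) =
    t • freeProdGen F A B (Sum.inl a) := by
  simpa [freeProdGen] using RingQuot.mkAlgHom_rel F (FreeProdRel.smul_left (A := A) (B := B) t a)

theorem freeProdGen_zero_left : freeProdGen F A B (Sum.inl 0) = 0 := by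
  simpa using freeProdGen_smul_left F (A := A) (B := B) 0 0

theorem freeProdGen_mul_left (a a' : A) : freeProdGen F A B (Sum.inl (a * a')) =
    freeProdGen F A B (Sum.inl a) * freeProdGen F A B (Sum.inl a') := by
  simpa [freeProdGen] using RingQuot.mkAlgHom_rel F (FreeProdRel.mul_left (A := A) (B := B) a a')

theorem freeProdGen_add_right (b b' : B) : freeProdGen F A B (Sum.inr (b + b')) =
    freeProdGen F A B (Sum.inr b) + freeProdGen F A B (Sum.inr b') := by
  simpa [freeProdGen] using RingQuot.mkAlgHom_rel F (FreeProdRel.add_right (A := A) (B := B) b b')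

theorem freeProdGen_smul_right (t : F) (b : B) : freeProdGen F A B (Sum.inr (t • b)) =
    t • freeProdGen F A B (Sum.inr b) := by
  simpa [freeProdGen] using RingQuot.mkAlgHom_rel F (FreeProdRel.smul_right (A := A) (B := B) t b)

theorem freeProdGen_zero_right : freeProdGen F A B (Sum.inr 0) = 0 := by
  simpa using freeProdGen_smul_right F (A := A) (B := B) 0 0

theorem freeProdGen_mul_right (b b' : B) : freeProdGen F A B (Sum.inr (b * b')) =
    freeProdGen F A B (Sum.inr b) * freeProdGen F A B (Sum.inr b') := by
  simpa [freeProdGen] using RingQuot.mkAlgHom_rel F (FreeProdRel.mul_right (A := A) (B := B) b b')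

/-- The first inclusion `A → A ⋆ B`. -/
def FreeProd.inl : A →ₙₐ[F] FreeProd F A B where
  toFun a := (⟨freeProdGen F A B (Sum.inl a), NonUnitalAlgebra.subset_adjoin F ⟨_, rfl⟩⟩ :
    FreeProdSub F A B)
  map_smul' t a := FreeProd.val_injective F (freeProdGen_smul_left F t a)
  map_zero' := FreeProd.val_injective F (freeProdGen_zero_left F)
  map_add' a a' := FreeProd.val_injective F (freeProdGen_add_left F a a')
  map_mul' a a' := FreeProd.val_injective F (freeProdGen_mul_left F a a')

/-- The second inclusion `B → A ⋆ B`. -/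
def FreeProd.inr : B →ₙₐ[F] FreeProd F A B where
  toFun b := (⟨freeProdGen F A B (Sum.inr b), NonUnitalAlgebra.subset_adjoin F ⟨_, rfl⟩⟩ :
    FreeProdSub F A B)
  map_smul' t b := FreeProd.val_injective F (freeProdGen_smul_right F t b)
  map_zero' := FreeProd.val_injective F (freeProdGen_zero_right F)
  map_add' b b' := FreeProd.val_injective F (freeProdGen_add_right F b b')
  map_mul' b b' := FreeProd.val_injective F (freeProdGen_mul_right F b b')

variable {F}

/-- The extension to unital envelopes of the morphism `A ⋆ B → C` with given components. -/
def freeProdLift (f : A →ₙₐ[F] C) (g : B →ₙₐ[F] C) :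
    RingQuot (FreeProdRel F A B) →ₐ[F] Unitization F C :=
  RingQuot.liftAlgHom F ⟨FreeAlgebra.lift F
    (Sum.elim (fun a => Unitization.inr (f a)) (fun b => Unitization.inr (g b))), by
      rintro _ _ (_ | _ | _ | _ | _ | _) <;> simp⟩

theorem freeProdLift_gen (f : A →ₙₐ[F] C) (g : B →ₙₐ[F] C) (x : A ⊕ B) :
    freeProdLift f g (freeProdGen F A B x) = Unitization.inr (Sum.elim f g x) := by
  rcases x with a | b <;> simp [freeProdLift, freeProdGen]

theorem freeProdLift_fst (f : A →ₙₐ[F] C) (g : B →ₙₐ[F] C) (x : FreeProd F A B) :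
    (freeProdLift f g (FreeProd.val F A B x)).fst = 0 := by
  obtain ⟨y, hy⟩ : ∃ y, y = FreeProd.val F A B x := ⟨_, rfl⟩
  have hx := FreeProd.val_mem F x
  rw [← hy] at hx ⊢
  clear hy
  induction hx using NonUnitalAlgebra.adjoin_induction with
  | mem x hx =>
    obtain ⟨y, rfl⟩ := hx
    simp [freeProdLift_gen]
  | add x y _ _ hx hy => simp [hx, hy]
  | zero => simp
  | mul x y _ _ hx hy => simp [hx, hy]
  | smul t x _ hx => simp [hx]

/-- The morphism `A ⋆ B → C` with given components. -/
def FreeProd.desc (f : A →ₙₐ[F] C) (g : B →ₙₐ[F] C) : FreeProd F A B →ₙₐ[F] C where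
  toFun x := (freeProdLift f g (FreeProd.val F A B x)).snd
  map_smul' t x := by simp
  map_zero' := by simp
  map_add' x y := by simp
  map_mul' x y := by simp [freeProdLift_fst]

@[simp] theorem FreeProd.desc_inl (f : A →ₙₐ[F] C) (g : B →ₙₐ[F] C) (a : A) :
    FreeProd.desc f g (FreeProd.inl F a) = f a :=
  congrArg (fun z : Unitization F C => z.snd) (freeProdLift_gen f g (Sum.inl a))

@[simp] theorem FreeProd.desc_inr (f : A →ₙₐ[F] C) (g : B →ₙₐ[F] C) (b : B) :
    FreeProd.desc f g (FreeProd.inr F b) = g b :=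
  congrArg (fun z : Unitization F C => z.snd) (freeProdLift_gen f g (Sum.inr b))

theorem FreeProd.hom_ext {f g : FreeProd F A B →ₙₐ[F] C}
    (hl : ∀ a, f (FreeProd.inl F a) = g (FreeProd.inl F a))
    (hr : ∀ b, f (FreeProd.inr F b) = g (FreeProd.inr F b)) : f = g := by
  refine NonUnitalAlgHom.ext ?_
  rintro ⟨x, hx⟩
  induction hx using NonUnitalAlgebra.adjoin_induction with
  | mem x hx =>
    obtain ⟨a | b, rfl⟩ := hx
    · exact hl a
    · exact hr b
  | add x y hx' hy' hx hy =>
    let x' : FreeProd F A B := (⟨x, hx'⟩ : FreeProdSub F A B)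
    let y' : FreeProd F A B := (⟨y, hy'⟩ : FreeProdSub F A B)
    exact (map_add f x' y').trans ((congrArg₂ (· + ·) hx hy).trans (map_add g x' y').symm)
  | zero => exact (map_zero f).trans (map_zero g).symm
  | mul x y hx' hy' hx hy =>
    let x' : FreeProd F A B := (⟨x, hx'⟩ : FreeProdSub F A B)
    let y' : FreeProd F A B := (⟨y, hy'⟩ : FreeProdSub F A B)
    exact (map_mul f x' y').trans ((congrArg₂ (· * ·) hx hy).trans (map_mul g x' y').symm)
  | smul t x hx' hx =>
    let x' : FreeProd F A B := (⟨x, hx'⟩ : FreeProdSub F A B)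
    exact (map_smul f t x').trans ((congrArg (t • ·) hx).trans (map_smul g t x').symm)

variable (F A)

/-- The codiagonal `A ⋆ A → A`, `a₁, a₂ ↦ a`. -/
def codiagonal : FreeProd F A A →ₙₐ[F] A :=
  FreeProd.desc (NonUnitalAlgHom.id F A) (NonUnitalAlgHom.id F A)

/-- The kernel of the codiagonal, as a subalgebra. -/
abbrev cuntzSub : NonUnitalSubalgebra F (FreeProd F A A) :=
  NonUnitalAlgHom.equalizer (codiagonal F A) (0 : FreeProd F A A →ₙₐ[F] A)

/-- Cuntz's algebra `qA`, the kernel of the codiagonal `A ⋆ A → A`. -/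
def Cuntz : Type _ := cuntzSub F A

instance : NonUnitalRing (Cuntz F A) := inferInstanceAs (NonUnitalRing (cuntzSub F A))
instance : Module F (Cuntz F A) := inferInstanceAs (Module F (cuntzSub F A))
instance : IsScalarTower F (Cuntz F A) (Cuntz F A) :=
  inferInstanceAs (IsScalarTower F (cuntzSub F A) (cuntzSub F A))
instance : SMulCommClass F (Cuntz F A) (Cuntz F A) :=
  inferInstanceAs (SMulCommClass F (cuntzSub F A) (cuntzSub F A))

/-- The inclusion `qA → A ⋆ A`. -/
def cuntzIncl : Cuntz F A →ₙₐ[F] FreeProd F A A where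
  toFun x := Subtype.val x
  map_smul' _ _ := rfl
  map_zero' := rfl
  map_add' _ _ := rfl
  map_mul' _ _ := rfl

variable {A}

theorem cuntzIncl_injective : Function.Injective (cuntzIncl F A) := Subtype.val_injective

@[simp] theorem codiagonal_cuntzIncl (x : Cuntz F A) : codiagonal F A (cuntzIncl F A x) = 0 := x.2

/-- Elements of the kernel of the codiagonal, as elements of `qA`. -/
def Cuntz.mk (x : FreeProd F A A) (h : codiagonal F A x = 0) : Cuntz F A :=
  (⟨x, h⟩ : cuntzSub F A)

@[simp] theorem cuntzIncl_mk (x : FreeProd F A A) (h : codiagonal F A x = 0) :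
    cuntzIncl F A (Cuntz.mk F x h) = x := rfl

variable {C : Type*} [NonUnitalRing C] [Module F C] [IsScalarTower F C C] [SMulCommClass F C C]

/-- A morphism into `A ⋆ A` killed by the codiagonal factors through `qA`. -/
def Cuntz.lift (f : C →ₙₐ[F] FreeProd F A A) (h : ∀ c, codiagonal F A (f c) = 0) :
    C →ₙₐ[F] Cuntz F A where
  toFun c := Cuntz.mk F (f c) (h c)
  map_smul' t c := cuntzIncl_injective F (by simp)
  map_zero' := cuntzIncl_injective F (by simp)
  map_add' c d := cuntzIncl_injective F (by simp)
  map_mul' c d := cuntzIncl_injective F (by simp)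

@[simp] theorem cuntzIncl_lift (f : C →ₙₐ[F] FreeProd F A A) (h : ∀ c, codiagonal F A (f c) = 0)
    (c : C) : cuntzIncl F A (Cuntz.lift F f h c) = f c := rfl

end FreeProduct

/-! ### Matrices -/

section Matrices

variable {F : Type*} [Field F]
variable {B : Type*} [NonUnitalRing B] [Module F B] [IsScalarTower F B B] [SMulCommClass F B B]
variable {ι κ μ : Type*} [Fintype ι] [DecidableEq ι] [Fintype κ] [DecidableEq κ]
  [Fintype μ] [DecidableEq μ]

variable (F) in
/-- The `0`-`1` matrix of an injection `σ` of index sets. -/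
def injMatrix (σ : ι ↪ κ) : Matrix κ ι F := Matrix.of fun k i => if k = σ i then 1 else 0

theorem injMatrix_transpose_mul (σ : ι ↪ κ) : (injMatrix F σ).transpose * injMatrix F σ = 1 := by
  ext i j
  simp [Matrix.mul_apply, injMatrix, Matrix.one_apply, eq_comm]

theorem injMatrix_transpose_mul_of_disjoint (σ : ι ↪ κ) (τ : μ ↪ κ) (h : ∀ i j, σ i ≠ τ j) :
    (injMatrix F σ).transpose * injMatrix F τ = 0 := by
  ext i j
  simpa [Matrix.mul_apply, injMatrix] using (h i j).symm

theorem injMatrix_trans (σ : ι ↪ κ) (τ : κ ↪ μ) :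
    injMatrix F (σ.trans τ) = injMatrix F τ * injMatrix F σ := by
  ext i j
  simp [Matrix.mul_apply, injMatrix]

variable (F) in
/-- Extension of matrices by zero along an injection `σ` of index sets: the matrix with entry
`M i j` at `(σ i, σ j)` and zeros elsewhere. -/
def corner (σ : ι ↪ κ) : Matrix ι ι F →ₙₐ[F] Matrix κ κ F where
  toFun M := injMatrix F σ * M * (injMatrix F σ).transpose
  map_smul' t M := by simp
  map_zero' := by simp
  map_add' M N := by simp [Matrix.mul_add, Matrix.add_mul]
  map_mul' M N := by
    calc injMatrix F σ * (M * N) * (injMatrix F σ).transpose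
        = injMatrix F σ * M * (1 : Matrix ι ι F) * N * (injMatrix F σ).transpose := by
          simp [Matrix.mul_assoc]
      _ = _ := by rw [← injMatrix_transpose_mul σ]; simp only [Matrix.mul_assoc]

theorem corner_apply (σ : ι ↪ κ) (M : Matrix ι ι F) :
    corner F σ M = injMatrix F σ * M * (injMatrix F σ).transpose := rfl

theorem corner_trans (σ : ι ↪ κ) (τ : κ ↪ μ) (M : Matrix ι ι F) :
    corner F (σ.trans τ) M = corner F τ (corner F σ M) := by
  simp only [corner_apply, injMatrix_trans, Matrix.transpose_mul, Matrix.mul_assoc]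

theorem corner_refl : corner F (Function.Embedding.refl ι) = NonUnitalAlgHom.id F _ := by
  ext M i j
  simp [corner_apply, injMatrix, Matrix.mul_apply]

theorem corner_mul_corner (σ : ι ↪ κ) (τ : μ ↪ κ) (h : ∀ i j, σ i ≠ τ j)
    (M : Matrix ι ι F) (N : Matrix μ μ F) : corner F σ M * corner F τ N = 0 := by
  calc corner F σ M * corner F τ N
      = injMatrix F σ * M * ((injMatrix F σ).transpose * injMatrix F τ) * N *
          (injMatrix F τ).transpose := by simp only [corner_apply, Matrix.mul_assoc]
    _ = 0 := by rw [injMatrix_transpose_mul_of_disjoint σ τ h]; simp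

variable (F B) in
/-- Extension by zero `M_ι(B) → M_κ(B)`, where `M_ι(B) = M_ι(F) ⊗ B`. -/
def push (σ : ι ↪ κ) : Matrix ι ι F ⊗[F] B →ₙₐ[F] Matrix κ κ F ⊗[F] B :=
  tmap (corner F σ) (NonUnitalAlgHom.id F B)

theorem push_trans (σ : ι ↪ κ) (τ : κ ↪ μ) :
    push F B (σ.trans τ) = (push F B τ).comp (push F B σ) :=
  tensor_hom_ext fun M b => by simp [push, corner_trans]

theorem push_refl : push F B (Function.Embedding.refl ι) = NonUnitalAlgHom.id F _ :=
  tensor_hom_ext fun M b => by simp [push, corner_refl]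

theorem push_mul_push (σ : ι ↪ κ) (τ : μ ↪ κ) (h : ∀ i j, σ i ≠ τ j)
    (x : Matrix ι ι F ⊗[F] B) (y : Matrix μ μ F ⊗[F] B) : push F B σ x * push F B τ y = 0 :=
  tmap_mul_tmap_eq_zero (corner_mul_corner σ τ h) _ _ _ _

variable (F B) in
/-- The block sum `M_ι(B) × M_μ(B) → M_κ(B)` along injections with disjoint images. -/
def blockHom (σ : ι ↪ κ) (τ : μ ↪ κ) (h : ∀ i j, σ i ≠ τ j) :
    (Matrix ι ι F ⊗[F] B) × (Matrix μ μ F ⊗[F] B) →ₙₐ[F] Matrix κ κ F ⊗[F] B :=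
  orthSum ((push F B σ).comp (NonUnitalAlgHom.fst F _ _))
    ((push F B τ).comp (NonUnitalAlgHom.snd F _ _))
    fun _ _ => ⟨push_mul_push σ τ h _ _, push_mul_push τ σ (fun i j => (h j i).symm) _ _⟩

@[simp] theorem blockHom_apply (σ : ι ↪ κ) (τ : μ ↪ κ) (h : ∀ i j, σ i ≠ τ j)
    (x : (Matrix ι ι F ⊗[F] B) × (Matrix μ μ F ⊗[F] B)) :
    blockHom F B σ τ h x = push F B σ x.1 + push F B τ x.2 := rfl

/-! #### The rotation homotopy -/

variable (F) in
/-- The idempotent `R⁻¹ e₀₀ R` for the rotation matrix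
`R = [[1 - x², x³ - 2x], [x, 1 - x²]]`. -/
def rotIdem : Matrix (Fin 2) (Fin 2) F[X] :=
  !![(1 - Polynomial.X ^ 2) ^ 2, (1 - Polynomial.X ^ 2) * (Polynomial.X ^ 3 - 2 * Polynomial.X);
    - Polynomial.X * (1 - Polynomial.X ^ 2),
    - Polynomial.X * (Polynomial.X ^ 3 - 2 * Polynomial.X)]

theorem rotIdem_mul_self : rotIdem F * rotIdem F = rotIdem F := by
  refine Matrix.ext fun i j => ?_
  fin_cases i <;> fin_cases j <;> simp [rotIdem, Matrix.mul_apply, Fin.sum_univ_two] <;> ring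

variable (F) in
/-- The idempotent `R⁻¹ e₀₀ R` inside `F[x] ⊗ M₂(F)`. -/
def rotP : F[X] ⊗[F] Matrix (Fin 2) (Fin 2) F := matrixEquivTensor (Fin 2) F F[X] (rotIdem F)

theorem rotP_mul_self : rotP F * rotP F = rotP F := by
  rw [rotP, ← map_mul, rotIdem_mul_self]

variable {D : Type*} [NonUnitalRing D] [Module F D] [IsScalarTower F D D] [SMulCommClass F D D]

/-- Tensoring with an idempotent. -/
def idemHom {Λ : Type*} [Ring Λ] [Algebra F Λ] (p : Λ) (hp : p * p = p) : D →ₙₐ[F] Λ ⊗[F] D :=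
  ofLinear (TensorProduct.mk F Λ D p) (by simp [hp])

@[simp] theorem idemHom_apply {Λ : Type*} [Ring Λ] [Algebra F Λ] (p : Λ) (hp : p * p = p) (d : D) :
    (idemHom p hp d : Λ ⊗[F] D) = p ⊗ₜ d := rfl

/-- The evaluation `F[x] ⊗ M₂(F) → M₂(F)`. -/
def evM (t : F) : F[X] ⊗[F] Matrix (Fin 2) (Fin 2) F →ₙₐ[F] Matrix (Fin 2) (Fin 2) F :=
  (evalAt t).comp commHom

@[simp] theorem evM_tmul (t : F) (p : F[X]) (M : Matrix (Fin 2) (Fin 2) F) :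
    evM t (p ⊗ₜ M) = p.eval t • M := by simp [evM]

theorem evM_rotP (t : F) : evM t (rotP F) = (rotIdem F).map (Polynomial.eval t) := by
  rw [rotP, matrixEquivTensor_apply]
  ext i j
  fin_cases i <;> fin_cases j <;> simp [Fintype.sum_prod_type, Fin.sum_univ_two]

theorem evM_rotP_zero : evM 0 (rotP F) = Matrix.single 0 0 1 := by
  rw [evM_rotP]
  ext i j
  fin_cases i <;> fin_cases j <;> simp [rotIdem]

theorem evM_rotP_one : evM 1 (rotP F) = Matrix.single 1 1 1 := by
  rw [evM_rotP]
  ext i j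
  fin_cases i <;> fin_cases j <;> simp [rotIdem]
  ring

/-- Reordering of the factors, as a map `(F[x] ⊗ M₂(F)) ⊗ D → (M₂(F) ⊗ D)[x]`. -/
def toPoly : (F[X] ⊗[F] Matrix (Fin 2) (Fin 2) F) ⊗[F] D →ₙₐ[F]
    (Matrix (Fin 2) (Fin 2) F ⊗[F] D) ⊗[F] F[X] :=
  commHom.comp assocHom

theorem evalAt_toPoly (t : F) (x : (F[X] ⊗[F] Matrix (Fin 2) (Fin 2) F) ⊗[F] D) :
    evalAt t (toPoly x) = tmap (evM t) (NonUnitalAlgHom.id F D) x := by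
  induction x with
  | zero => simp
  | add x y hx hy => simp only [map_add, hx, hy]
  | tmul a d =>
    induction a with
    | zero => simp
    | add x y hx hy => simp only [map_add, TensorProduct.add_tmul, hx, hy]
    | tmul p M => simp [toPoly, TensorProduct.smul_tmul']

variable (F D) in
/-- The embedding of `D` as the `i`-th diagonal entry of `M₂(D)`. -/
def diagHom (i : Fin 2) : D →ₙₐ[F] Matrix (Fin 2) (Fin 2) F ⊗[F] D :=
  idemHom (Matrix.single i i 1) (by simp)

theorem diagHom_elemHomotopic : ElemHomotopic (diagHom F D 0) (diagHom F D 1) :=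
  ⟨toPoly.comp (idemHom (rotP F) rotP_mul_self),
    by ext d; simp [evalAt_toPoly, evM_rotP_zero, diagHom],
    by ext d; simp [evalAt_toPoly, evM_rotP_one, diagHom]⟩

/-- The Kronecker product `M₂(F) ⊗ M_ι(F) → M_{2 × ι}(F)`, followed by extension by zero. -/
def kronHom (ρ : Fin 2 × ι ↪ κ) :
    Matrix (Fin 2) (Fin 2) F ⊗[F] Matrix ι ι F →ₙₐ[F] Matrix κ κ F :=
  (corner F ρ).comp
    (Matrix.kroneckerAlgEquiv (Fin 2) ι F : _ →ₐ[F] Matrix (Fin 2 × ι) (Fin 2 × ι) F).toNonUnitalAlgHom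

/-- The map `M₂(M_ι(B)) → M_κ(B)` induced by `2 × ι ↪ κ`. -/
def kappa (ρ : Fin 2 × ι ↪ κ) :
    Matrix (Fin 2) (Fin 2) F ⊗[F] (Matrix ι ι F ⊗[F] B) →ₙₐ[F] Matrix κ κ F ⊗[F] B :=
  (tmap (kronHom ρ) (NonUnitalAlgHom.id F B)).comp assocInvHom

/-- The `a`-th slice of an injection `2 × ι ↪ κ`. -/
def slice (ρ : Fin 2 × ι ↪ κ) (a : Fin 2) : ι ↪ κ :=
  ⟨fun i => ρ (a, i), fun i j h => by simpa using ρ.injective h⟩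

theorem kronHom_single (ρ : Fin 2 × ι ↪ κ) (a : Fin 2) (M : Matrix ι ι F) :
    kronHom ρ (Matrix.single a a 1 ⊗ₜ M) = corner F (slice ρ a) M := by
  have h : slice ρ a = (slice (Function.Embedding.refl _) a).trans ρ := rfl
  rw [h, corner_trans]
  change corner F ρ (Matrix.kroneckerAlgEquiv (Fin 2) ι F (Matrix.single a a 1 ⊗ₜ M)) = _
  congr 1
  ext ⟨b, i⟩ ⟨c, j⟩
  simp only [corner_apply, injMatrix, slice, Matrix.mul_apply, Matrix.kroneckerAlgEquiv_apply,
    kroneckerLinearEquiv_tmul, Matrix.kroneckerMap_apply, Matrix.single_apply,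
    Matrix.of_apply, Matrix.transpose_apply]
  by_cases hb : a = b
  · subst hb
    by_cases hc : a = c
    · subst hc
      simp
    · have hc' : ¬ c = a := fun h => hc h.symm
      simp [hc, hc']
  · have hb' : ¬ b = a := fun h => hb h.symm
    simp [hb, hb']

theorem kappa_diagHom (ρ : Fin 2 × ι ↪ κ) (a : Fin 2) :
    (kappa (F := F) (B := B) ρ).comp (diagHom F (Matrix ι ι F ⊗[F] B) a) = push F B (slice ρ a) :=
  tensor_hom_ext fun M b => by simp [kappa, diagHom, kronHom_single, push]

theorem push_homotopic_of_disjoint (σ τ : ι ↪ κ) (h : ∀ i j, σ i ≠ τ j) :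
    ElemHomotopic (push F B σ) (push F B τ) := by
  let ρ : Fin 2 × ι ↪ κ := ⟨fun x => if x.1 = 0 then σ x.2 else τ x.2, by
    rintro ⟨a, i⟩ ⟨b, j⟩ hab
    fin_cases a <;> fin_cases b <;> simp_all [eq_comm]⟩
  have h0 : slice ρ 0 = σ := Function.Embedding.ext fun i => (if_pos rfl : (if (0 : Fin 2) = 0 then σ i else τ i) = σ i)
  have h1 : slice ρ 1 = τ := Function.Embedding.ext fun i =>
    (if_neg (by decide) : (if (1 : Fin 2) = 0 then σ i else τ i) = τ i)
  rw [← h0, ← h1, ← kappa_diagHom, ← kappa_diagHom]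
  exact diagHom_elemHomotopic.comp_left _

end Matrices

/-! ### The switch of `qA` is an inverse up to homotopy -/

section Switch

variable (F : Type*) [Field F]
variable (A : Type*) [NonUnitalRing A] [Module F A] [IsScalarTower F A A] [SMulCommClass F A A]

/-- The switch of the two factors of `A ⋆ A`. -/
def switchFree : FreeProd F A A →ₙₐ[F] FreeProd F A A :=
  FreeProd.desc (FreeProd.inr F) (FreeProd.inl F)

theorem codiagonal_switchFree (x : FreeProd F A A) :
    codiagonal F A (switchFree F A x) = codiagonal F A x := by
  have : (codiagonal F A).comp (switchFree F A) = codiagonal F A :=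
    FreeProd.hom_ext (by simp [codiagonal, switchFree]) (by simp [codiagonal, switchFree])
  exact NonUnitalAlgHom.congr_fun this x

/-- The switch of `qA`. -/
def switch : Cuntz F A →ₙₐ[F] Cuntz F A :=
  Cuntz.lift F ((switchFree F A).comp (cuntzIncl F A)) fun x => by
    simp [codiagonal_switchFree]

variable {A}

/-- The morphism `a ↦ e ⊗ i(a) + f ⊗ j(a)` for orthogonal idempotents `e, f`. -/
def twoIdem {Λ C : Type*} [Ring Λ] [Algebra F Λ]
    [NonUnitalRing C] [Module F C] [IsScalarTower F C C] [SMulCommClass F C C]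
    (e f : Λ) (he : e * e = e) (hf : f * f = f) (hef : e * f = 0) (hfe : f * e = 0)
    (i j : A →ₙₐ[F] C) : A →ₙₐ[F] Λ ⊗[F] C :=
  orthSum ((idemHom e he).comp i) ((idemHom f hf).comp j) fun a b => by simp [hef, hfe]

theorem twoIdem_apply {Λ C : Type*} [Ring Λ] [Algebra F Λ]
    [NonUnitalRing C] [Module F C] [IsScalarTower F C C] [SMulCommClass F C C]
    (e f : Λ) (he : e * e = e) (hf : f * f = f) (hef : e * f = 0) (hfe : f * e = 0)
    (i j : A →ₙₐ[F] C) (a : A) :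
    twoIdem F e f he hf hef hfe i j a = e ⊗ₜ i a + f ⊗ₜ j a := rfl

variable (A)

/-- The diagonal idempotents of `M₂(F)`. -/
def idemM (i : Fin 2) : Matrix (Fin 2) (Fin 2) F := Matrix.single i i 1

theorem idemM_mul_self (i : Fin 2) : idemM F i * idemM F i = idemM F i := by simp [idemM]
theorem idemM_mul_zero_one : idemM F 0 * idemM F 1 = 0 := by simp [idemM]
theorem idemM_mul_one_zero : idemM F 1 * idemM F 0 = 0 := by simp [idemM]

theorem idemM_add : idemM F 0 + idemM F 1 = 1 := by
  ext i j
  fin_cases i <;> fin_cases j <;> simp [idemM]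

/-- The diagonal idempotents, as constants in `F[x] ⊗ M₂(F)`. -/
def idemP (i : Fin 2) : F[X] ⊗[F] Matrix (Fin 2) (Fin 2) F := 1 ⊗ₜ idemM F i

theorem idemP_add : idemP F 0 + idemP F 1 = 1 := by
  rw [idemP, idemP, ← TensorProduct.tmul_add, idemM_add]
  rfl

theorem evM_idemP (t : F) (i : Fin 2) : evM t (idemP F i) = idemM F i := by
  rw [idemP, evM_tmul]
  simp

theorem evM_one (t : F) : evM t (1 : F[X] ⊗[F] Matrix (Fin 2) (Fin 2) F) = 1 := by
  rw [Algebra.TensorProduct.one_def, evM_tmul]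
  simp

/-- The morphism `a ↦ diag(a₂, a₁)`. -/
def rotFree₁ : A →ₙₐ[F] (F[X] ⊗[F] Matrix (Fin 2) (Fin 2) F) ⊗[F] FreeProd F A A :=
  twoIdem F (idemP F 0) (idemP F 1) (by simp [idemP, idemM_mul_self])
    (by simp [idemP, idemM_mul_self]) (by simp [idemP, idemM_mul_zero_one])
    (by simp [idemP, idemM_mul_one_zero]) (FreeProd.inr F) (FreeProd.inl F)

theorem rotFree₁_apply (a : A) : rotFree₁ F A a =
    idemP F 0 ⊗ₜ FreeProd.inr F a + idemP F 1 ⊗ₜ FreeProd.inl F a := rfl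

/-- The morphism `a ↦ R⁻¹ diag(a₁, a₂) R`. -/
def rotFree₂ : A →ₙₐ[F] (F[X] ⊗[F] Matrix (Fin 2) (Fin 2) F) ⊗[F] FreeProd F A A :=
  twoIdem F (rotP F) (1 - rotP F) rotP_mul_self (by simp [mul_sub, sub_mul, rotP_mul_self])
    (by simp [mul_sub, rotP_mul_self]) (by simp [sub_mul, rotP_mul_self])
    (FreeProd.inl F) (FreeProd.inr F)

/-- The morphism `A ⋆ A → M₂(A ⋆ A)[x]` sending `a₁` to `diag(a₂, a₁)` and `a₂` to
`R⁻¹ diag(a₁, a₂) R`. -/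
def rotFree : FreeProd F A A →ₙₐ[F] (F[X] ⊗[F] Matrix (Fin 2) (Fin 2) F) ⊗[F] FreeProd F A A :=
  FreeProd.desc (F := F) (A := A) (B := A)
    (C := (F[X] ⊗[F] Matrix (Fin 2) (Fin 2) F) ⊗[F] FreeProd F A A) (rotFree₁ F A) (rotFree₂ F A)

theorem codiagonal_rotFree (x : FreeProd F A A) :
    tmap (NonUnitalAlgHom.id F _) (codiagonal F A) (rotFree F A x) =
      (1 : F[X] ⊗[F] Matrix (Fin 2) (Fin 2) F) ⊗ₜ codiagonal F A x := by
  have : (tmap (NonUnitalAlgHom.id F _) (codiagonal F A)).comp (rotFree F A) =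
      (idemHom (1 : F[X] ⊗[F] Matrix (Fin 2) (Fin 2) F) (by simp)).comp (codiagonal F A) :=
    FreeProd.hom_ext (C := (F[X] ⊗[F] Matrix (Fin 2) (Fin 2) F) ⊗[F] A)
      (fun a => by
        simp [codiagonal, rotFree, rotFree₁_apply, ← TensorProduct.add_tmul, idemP_add])
      (fun a => by
        simp [codiagonal, rotFree, rotFree₂, twoIdem, ← TensorProduct.add_tmul])
  exact NonUnitalAlgHom.congr_fun this x

theorem cuntz_exact : Function.Exact (cuntzIncl F A : Cuntz F A →ₗ[F] FreeProd F A A)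
    (codiagonal F A : FreeProd F A A →ₗ[F] A) := by
  intro x
  constructor
  · intro hx
    exact ⟨Cuntz.mk F x hx, rfl⟩
  · rintro ⟨y, rfl⟩
    exact codiagonal_cuntzIncl F y

theorem codiagonal_surjective :
    Function.Surjective (codiagonal F A : FreeProd F A A →ₗ[F] A) :=
  fun a => ⟨FreeProd.inl F a, by simp [codiagonal]⟩

theorem tmap_incl_injective (Λ : Type*) [Ring Λ] [Algebra F Λ] :
    Function.Injective (tmap (NonUnitalAlgHom.id F Λ) (cuntzIncl F A)) :=
  Module.Flat.lTensor_preserves_injective_linearMap (M := Λ)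
    (cuntzIncl F A : Cuntz F A →ₗ[F] FreeProd F A A) (cuntzIncl_injective F)

theorem rotFree_mem_range (x : Cuntz F A) :
    ∃ y, tmap (NonUnitalAlgHom.id F (F[X] ⊗[F] Matrix (Fin 2) (Fin 2) F)) (cuntzIncl F A) y =
      rotFree F A (cuntzIncl F A x) := by
  refine (lTensor_exact (F[X] ⊗[F] Matrix (Fin 2) (Fin 2) F) (cuntz_exact F A)
    (codiagonal_surjective F A) (rotFree F A (cuntzIncl F A x))).1 ?_
  refine (codiagonal_rotFree F A _).trans ?_
  have := codiagonal_cuntzIncl F x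
  rw [this, TensorProduct.tmul_zero]

/-- A morphism landing in the image of an injective morphism, with restricted codomain. -/
def liftInjective {A B C : Type*}
    [NonUnitalRing A] [Module F A] [IsScalarTower F A A] [SMulCommClass F A A]
    [NonUnitalRing B] [Module F B] [IsScalarTower F B B] [SMulCommClass F B B]
    [NonUnitalRing C] [Module F C] [IsScalarTower F C C] [SMulCommClass F C C]
    (i : B →ₙₐ[F] C) (inj : Function.Injective i) (f : A →ₙₐ[F] C) (h : ∀ a, ∃ b, i b = f a) :
    A →ₙₐ[F] B where
  toFun a := (h a).choose
  map_smul' t a := inj <| by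
    rw [MonoidHom.id_apply, map_smul i]
    exact (h _).choose_spec.trans <| (map_smul f t a).trans (congrArg _ (h a).choose_spec.symm)
  map_zero' := inj <| (h _).choose_spec.trans <| (map_zero f).trans (map_zero i).symm
  map_add' a b := inj <| by
    rw [map_add i]
    exact (h _).choose_spec.trans <| (map_add f a b).trans
      (congrArg₂ _ (h a).choose_spec.symm (h b).choose_spec.symm)
  map_mul' a b := inj <| by
    rw [map_mul i]
    exact (h _).choose_spec.trans <| (map_mul f a b).trans
      (congrArg₂ _ (h a).choose_spec.symm (h b).choose_spec.symm)

/-- The restriction of `rotFree` to `qA`. -/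
def rotCuntz : Cuntz F A →ₙₐ[F] (F[X] ⊗[F] Matrix (Fin 2) (Fin 2) F) ⊗[F] Cuntz F A :=
  liftInjective F _ (tmap_incl_injective F A (F[X] ⊗[F] Matrix (Fin 2) (Fin 2) F))
    ((rotFree F A).comp (cuntzIncl F A)) (rotFree_mem_range F A)

theorem rotCuntz_spec (x : Cuntz F A) :
    tmap (NonUnitalAlgHom.id F _) (cuntzIncl F A) (rotCuntz F A x) =
      rotFree F A (cuntzIncl F A x) :=
  (rotFree_mem_range F A x).choose_spec

theorem evM_rotFree_zero (x : FreeProd F A A) :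
    tmap (evM 0) (NonUnitalAlgHom.id F _) (rotFree F A x) =
      idemM F 0 ⊗ₜ switchFree F A x + idemM F 1 ⊗ₜ x := by
  have h : (tmap (evM 0) (NonUnitalAlgHom.id F _)).comp (rotFree F A) =
      twoIdem F (idemM F 0) (idemM F 1) (idemM_mul_self F 0) (idemM_mul_self F 1)
        (idemM_mul_zero_one F) (idemM_mul_one_zero F) (switchFree F A) (NonUnitalAlgHom.id F _) := by
    refine FreeProd.hom_ext (fun a => ?_) (fun a => ?_)
    · simp [rotFree, rotFree₁_apply, twoIdem_apply, switchFree, evM_idemP]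
    · have h0 : evM 0 (rotP F) = idemM F 0 := evM_rotP_zero
      simp [rotFree, rotFree₂, twoIdem, switchFree, h0, evM_one, ← idemM_add F]
  exact NonUnitalAlgHom.congr_fun h x

theorem evM_rotFree_one (x : FreeProd F A A) :
    tmap (evM 1) (NonUnitalAlgHom.id F _) (rotFree F A x) =
      idemM F 0 ⊗ₜ FreeProd.inr F (codiagonal F A x) +
      idemM F 1 ⊗ₜ FreeProd.inl F (codiagonal F A x) := by
  have h : (tmap (evM 1) (NonUnitalAlgHom.id F _)).comp (rotFree F A) =
      twoIdem F (idemM F 0) (idemM F 1) (idemM_mul_self F 0) (idemM_mul_self F 1)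
        (idemM_mul_zero_one F) (idemM_mul_one_zero F) ((FreeProd.inr F).comp (codiagonal F A))
        ((FreeProd.inl F).comp (codiagonal F A)) := by
    refine FreeProd.hom_ext (fun a => ?_) (fun a => ?_)
    · simp [rotFree, rotFree₁_apply, twoIdem_apply, codiagonal, evM_idemP]
    · have h0 : evM 1 (rotP F) = idemM F 1 := evM_rotP_one
      simp [rotFree, rotFree₂, twoIdem, codiagonal, h0, evM_one, ← idemM_add F, add_comm]
  exact NonUnitalAlgHom.congr_fun h x

/-- The morphism `w ↦ diag(s(w), w)`, where `s` is the switch. -/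
def switchDiag : Cuntz F A →ₙₐ[F] Matrix (Fin 2) (Fin 2) F ⊗[F] Cuntz F A :=
  twoIdem F (idemM F 0) (idemM F 1) (idemM_mul_self F 0) (idemM_mul_self F 1)
        (idemM_mul_zero_one F) (idemM_mul_one_zero F) (switch F A) (NonUnitalAlgHom.id F _)

theorem tmap_tmap {A A' B B' A'' B'' : Type*}
    [NonUnitalRing A] [Module F A] [IsScalarTower F A A] [SMulCommClass F A A]
    [NonUnitalRing A'] [Module F A'] [IsScalarTower F A' A'] [SMulCommClass F A' A']
    [NonUnitalRing B] [Module F B] [IsScalarTower F B B] [SMulCommClass F B B]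
    [NonUnitalRing B'] [Module F B'] [IsScalarTower F B' B'] [SMulCommClass F B' B']
    [NonUnitalRing A''] [Module F A''] [IsScalarTower F A'' A''] [SMulCommClass F A'' A'']
    [NonUnitalRing B''] [Module F B''] [IsScalarTower F B'' B''] [SMulCommClass F B'' B'']
    (f : A →ₙₐ[F] A') (g : B →ₙₐ[F] B') (f' : A' →ₙₐ[F] A'') (g' : B' →ₙₐ[F] B'')
    (x : A ⊗[F] B) : tmap f' g' (tmap f g x) = tmap (f'.comp f) (g'.comp g) x := by
  have : (tmap f' g').comp (tmap f g) = tmap (f'.comp f) (g'.comp g) :=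
    tensor_hom_ext fun a b => by simp
  exact NonUnitalAlgHom.congr_fun this x

theorem tmap_incl_evM (t : F) (x : (F[X] ⊗[F] Matrix (Fin 2) (Fin 2) F) ⊗[F] Cuntz F A) :
    tmap (NonUnitalAlgHom.id F _) (cuntzIncl F A) (tmap (evM t) (NonUnitalAlgHom.id F _) x) =
      tmap (evM t) (NonUnitalAlgHom.id F _) (tmap (NonUnitalAlgHom.id F _) (cuntzIncl F A) x) := by
  rw [tmap_tmap, tmap_tmap]
  rfl

theorem switchDiag_elemHomotopic : ElemHomotopic (switchDiag F A) 0 := by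
  refine ⟨toPoly.comp (rotCuntz F A), ?_, ?_⟩
  · ext x
    apply tmap_incl_injective F A
    rw [NonUnitalAlgHom.comp_apply, NonUnitalAlgHom.comp_apply, evalAt_toPoly, tmap_incl_evM,
      rotCuntz_spec, evM_rotFree_zero]
    rfl
  · ext x
    apply tmap_incl_injective F A
    rw [NonUnitalAlgHom.comp_apply, NonUnitalAlgHom.comp_apply, evalAt_toPoly, tmap_incl_evM,
      rotCuntz_spec, evM_rotFree_one]
    have := codiagonal_cuntzIncl F x
    simp [this]

end Switch

/-! ### The category of algebras and its homotopy category -/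

/-- An (associative, not necessarily commutative or unital) algebra over the field `F`. -/
structure NAlg (F : Type u) [Field F] where
  /-- The underlying type. -/
  carrier : Type u
  [ring : NonUnitalRing carrier]
  [module : Module F carrier]
  [tower : IsScalarTower F carrier carrier]
  [comm : SMulCommClass F carrier carrier]

attribute [instance] NAlg.ring NAlg.module NAlg.tower NAlg.comm

section Hot

variable {F : Type u} [Field F]

/-- The category of algebras and their morphisms. -/
instance : Category (NAlg F) where
  Hom A B := A.carrier →ₙₐ[F] B.carrier
  id A := NonUnitalAlgHom.id F A.carrier
  comp f g := NonUnitalAlgHom.comp g f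

variable (F) in
/-- Homotopy, as a relation on the morphisms of the category of algebras. -/
def homotopyRel : HomRel (NAlg F) := fun A B f g =>
  Homotopic (A := A.carrier) (B := B.carrier) f g

instance : Congruence (homotopyRel F) where
  comp_left f _ _ h := Homotopic.comp_right h f
  comp_right g h := Homotopic.comp_left h g
  equivalence := ⟨fun _ => Relation.ReflTransGen.refl, Homotopic.symm, Relation.ReflTransGen.trans⟩

variable (F) in
/-- The homotopy category of algebras: algebras, and homotopy classes of morphisms. -/
abbrev HotCat := CategoryTheory.Quotient (homotopyRel F)

variable (F) in
/-- The functor sending a morphism to its homotopy class. -/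
abbrev toHot : NAlg F ⥤ HotCat F := CategoryTheory.Quotient.functor (homotopyRel F)

theorem toHot_map_eq_iff {A B : NAlg F} (f g : A ⟶ B) :
    (toHot F).map f = (toHot F).map g ↔
      Homotopic (F := F) (A := A.carrier) (B := B.carrier) f g :=
  CategoryTheory.Quotient.functor_map_eq_iff (homotopyRel F) f g

/-- The coproduct of two algebras. -/
def NAlg.coprod (A B : NAlg F) : NAlg F := ⟨FreeProd F A.carrier B.carrier⟩

/-- The first inclusion. -/
def NAlg.inl (A B : NAlg F) : A ⟶ A.coprod B :=
  (FreeProd.inl F : A.carrier →ₙₐ[F] FreeProd F A.carrier B.carrier)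

/-- The second inclusion. -/
def NAlg.inr (A B : NAlg F) : B ⟶ A.coprod B :=
  (FreeProd.inr F : B.carrier →ₙₐ[F] FreeProd F A.carrier B.carrier)

/-- The morphism out of the coproduct with given components. -/
def NAlg.desc {A B C : NAlg F} (f : A ⟶ C) (g : B ⟶ C) : A.coprod B ⟶ C :=
  (FreeProd.desc (F := F) (A := A.carrier) (B := B.carrier) (C := C.carrier) f g :
    FreeProd F A.carrier B.carrier →ₙₐ[F] C.carrier)

theorem NAlg.inl_desc {A B C : NAlg F} (f : A ⟶ C) (g : B ⟶ C) :
    NAlg.inl A B ≫ NAlg.desc f g = f :=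
  NonUnitalAlgHom.ext fun a =>
    FreeProd.desc_inl (F := F) (A := A.carrier) (B := B.carrier) (C := C.carrier) f g a

theorem NAlg.inr_desc {A B C : NAlg F} (f : A ⟶ C) (g : B ⟶ C) :
    NAlg.inr A B ≫ NAlg.desc f g = g :=
  NonUnitalAlgHom.ext fun a =>
    FreeProd.desc_inr (F := F) (A := A.carrier) (B := B.carrier) (C := C.carrier) f g a

theorem NAlg.eq_desc {A B C : NAlg F} (h : A.coprod B ⟶ C) :
    h = NAlg.desc (NAlg.inl A B ≫ h) (NAlg.inr A B ≫ h) :=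
  FreeProd.hom_ext (F := F) (A := A.carrier) (B := B.carrier) (C := C.carrier)
    (fun a => (NonUnitalAlgHom.congr_fun (NAlg.inl_desc (NAlg.inl A B ≫ h) (NAlg.inr A B ≫ h)) a).symm)
    (fun a => (NonUnitalAlgHom.congr_fun (NAlg.inr_desc (NAlg.inl A B ≫ h) (NAlg.inr A B ≫ h)) a).symm)

theorem desc_homotopic {A B C : Type*}
    [NonUnitalRing A] [Module F A] [IsScalarTower F A A] [SMulCommClass F A A]
    [NonUnitalRing B] [Module F B] [IsScalarTower F B B] [SMulCommClass F B B]
    [NonUnitalRing C] [Module F C] [IsScalarTower F C C] [SMulCommClass F C C]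
    {f f' : A →ₙₐ[F] C} {g g' : B →ₙₐ[F] C} (hf : Homotopic f f') (hg : Homotopic g g') :
    Homotopic (FreeProd.desc f g) (FreeProd.desc f' g') := by
  have key : ∀ {f f' : A →ₙₐ[F] C} {g g' : B →ₙₐ[F] C}, ElemHomotopic f f' → ElemHomotopic g g' →
      ElemHomotopic (FreeProd.desc f g) (FreeProd.desc f' g') := by
    rintro _ _ _ _ ⟨H, rfl, rfl⟩ ⟨K, rfl, rfl⟩
    refine ⟨FreeProd.desc (F := F) (A := A) (B := B) (C := C ⊗[F] F[X]) H K, ?_, ?_⟩ <;>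
      exact FreeProd.hom_ext (fun a => by simp) (fun a => by simp)
  exact (Relation.ReflTransGen.lift (fun f : A →ₙₐ[F] C => FreeProd.desc f g)
    (fun _ _ h => key h (ElemHomotopic.refl g)) _ _ hf).trans
    (Relation.ReflTransGen.lift (fun g : B →ₙₐ[F] C => FreeProd.desc f' g)
    (fun _ _ h => key (ElemHomotopic.refl f') h) _ _ hg)

instance : HasInitial (HotCat F) := by
  refine (IsInitial.ofUniqueHom (X := (toHot F).obj ⟨PUnit⟩)
    (fun Y => (toHot F).map (Y := Y.as) (0 : PUnit →ₙₐ[F] Y.as.carrier)) ?_).hasInitial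
  rintro ⟨Y⟩ m
  obtain ⟨m, rfl⟩ := (toHot F).map_surjective m
  exact congrArg _ (NonUnitalAlgHom.ext fun x =>
    map_zero (show PUnit →ₙₐ[F] Y.carrier from m))

theorem toHot_existsUnique_desc {A B : NAlg F} {T : HotCat F} (f : (toHot F).obj A ⟶ T)
    (g : (toHot F).obj B ⟶ T) : ∃! h : (toHot F).obj (A.coprod B) ⟶ T,
      (toHot F).map (NAlg.inl A B) ≫ h = f ∧ (toHot F).map (NAlg.inr A B) ≫ h = g := by
  obtain ⟨T⟩ := T
  obtain ⟨f, rfl⟩ := (toHot F).map_surjective (X := A) (Y := T) f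
  obtain ⟨g, rfl⟩ := (toHot F).map_surjective (X := B) (Y := T) g
  refine ⟨(toHot F).map (NAlg.desc f g), ⟨?_, ?_⟩, ?_⟩
  · exact ((toHot F).map_comp _ _).symm.trans (congrArg _ (NAlg.inl_desc f g))
  · exact ((toHot F).map_comp _ _).symm.trans (congrArg _ (NAlg.inr_desc f g))
  · rintro h ⟨h1, h2⟩
    obtain ⟨h, rfl⟩ := (toHot F).map_surjective (X := A.coprod B) (Y := T) h
    have h1' := (toHot_map_eq_iff _ _).1 (((toHot F).map_comp _ _).trans h1)
    have h2' := (toHot_map_eq_iff _ _).1 (((toHot F).map_comp _ _).trans h2)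
    refine (congrArg _ (NAlg.eq_desc h)).trans ((toHot_map_eq_iff _ _).2 ?_)
    exact desc_homotopic (F := F) (A := A.carrier) (B := B.carrier) (C := T.carrier) h1' h2'

instance : HasBinaryCoproducts (HotCat F) := by
  have : ∀ {X Y : HotCat F}, HasColimit (pair X Y) := by
    rintro ⟨A⟩ ⟨B⟩
    exact ⟨⟨⟨BinaryCofan.mk (P := (toHot F).obj (A.coprod B)) ((toHot F).map (NAlg.inl A B))
      ((toHot F).map (NAlg.inr A B)),
      BinaryCofan.IsColimit.mk _ (fun f g => (toHot_existsUnique_desc f g).choose)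
        (fun f g => (toHot_existsUnique_desc f g).choose_spec.1.1)
        (fun f g => (toHot_existsUnique_desc f g).choose_spec.1.2)
        (fun f g m h1 h2 => (toHot_existsUnique_desc f g).choose_spec.2 m ⟨h1, h2⟩)⟩⟩⟩
  exact hasBinaryCoproducts_of_hasColimit_pair _

instance : HasFiniteCoproducts (HotCat F) := hasFiniteCoproducts_of_has_binary_and_initial

end Hot

/-! ### Pro-objects -/

/-- A pro-object of `C`: an inverse system over a (nonempty) directed set. -/
structure Pro (C : Type u) [Category.{v} C] where
  /-- The index set. -/
  Idx : Type w
  [pre : Preorder Idx]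
  [dir : IsDirectedOrder Idx]
  [ne : Nonempty Idx]
  /-- The objects of the system. -/
  obj : Idx → C
  /-- The transition morphisms of the system. -/
  map : ∀ {i i' : Idx}, i ≤ i' → (obj i' ⟶ obj i)
  map_refl : ∀ i, map (le_refl i) = 𝟙 (obj i)
  map_trans : ∀ {i i' i'' : Idx} (h : i ≤ i') (h' : i' ≤ i''),
    map (h.trans h') = map h' ≫ map h

attribute [instance] Pro.pre Pro.dir Pro.ne

namespace Pro

section Basic

variable {C : Type u} [Category.{v} C] {D : Type u} [Category.{v} D]

theorem map_trans_assoc' (X : Pro.{u, v, w} C) {i i' i'' : X.Idx} (h : i ≤ i') (h' : i' ≤ i'')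
    {Z : C} (f : X.obj i ⟶ Z) : X.map h' ≫ X.map h ≫ f = X.map (h.trans h') ≫ f := by
  rw [X.map_trans h h', Category.assoc]

theorem map_eq_of_le (X : Pro.{u, v, w} C) {i i' k l : X.Idx} {h₁ : k ≤ i} {h₂ : l ≤ i} {Z : C}
    {f : X.obj k ⟶ Z} {g : X.obj l ⟶ Z} (e : X.map h₁ ≫ f = X.map h₂ ≫ g) (h : i ≤ i') :
    X.map (h₁.trans h) ≫ f = X.map (h₂.trans h) ≫ g := by
  rw [← map_trans_assoc' X h₁ h, e, map_trans_assoc']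

/-- A represented morphism of pro-objects: a function `f` from the indices of `Y` to the indices of
`X`, and morphisms `X_{f(j)} → Y_j` that are compatible with the transition morphisms after passing
to a large enough index of `X`. -/
structure PreHom (X Y : Pro.{u, v, w} C) where
  /-- The function on indices. -/
  idx : Y.Idx → X.Idx
  /-- The morphisms. -/
  hom : ∀ j, X.obj (idx j) ⟶ Y.obj j
  compat : ∀ {j j' : Y.Idx} (h : j ≤ j'), ∃ (i : X.Idx) (h₁ : idx j ≤ i) (h₂ : idx j' ≤ i),
    X.map h₁ ≫ hom j = X.map h₂ ≫ hom j' ≫ Y.map h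

/-- Two represented morphisms are equivalent if their components agree after passing to large enough
indices. -/
def PreHom.Rel {X Y : Pro.{u, v, w} C} (f g : PreHom X Y) : Prop :=
  ∀ j, ∃ (i : X.Idx) (h₁ : f.idx j ≤ i) (h₂ : g.idx j ≤ i),
    X.map h₁ ≫ f.hom j = X.map h₂ ≫ g.hom j

theorem PreHom.Rel.of_eq {X Y : Pro.{u, v, w} C} {f g : PreHom X Y} (h : ∀ j, f.idx j = g.idx j)
    (h' : ∀ j, f.hom j = X.map (h j).ge ≫ g.hom j) : PreHom.Rel f g := fun j =>
  ⟨f.idx j, le_rfl, (h j).ge, by rw [X.map_refl, Category.id_comp, h' j]⟩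

/-- The equivalence relation on represented morphisms. -/
instance PreHom.setoid (X Y : Pro.{u, v, w} C) : Setoid (PreHom X Y) where
  r := PreHom.Rel
  iseqv :=
    { refl := fun f j => ⟨f.idx j, le_rfl, le_rfl, rfl⟩
      symm := fun h j => by
        obtain ⟨i, h₁, h₂, e⟩ := h j
        exact ⟨i, h₂, h₁, e.symm⟩
      trans := fun {f g k} h h' j => by
        obtain ⟨i, h₁, h₂, e⟩ := h j
        obtain ⟨i', h₁', h₂', e'⟩ := h' j
        obtain ⟨m, hm, hm'⟩ := exists_ge_ge i i'
        exact ⟨m, h₁.trans hm, h₂'.trans hm', (map_eq_of_le X e hm).trans (map_eq_of_le X e' hm')⟩ }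

/-- The identity. -/
def PreHom.id (X : Pro.{u, v, w} C) : PreHom X X where
  idx j := j
  hom j := 𝟙 _
  compat {j j'} h := ⟨j', h, le_rfl, by simp [X.map_refl]⟩

/-- The composition of represented morphisms. -/
def PreHom.comp {X Y Z : Pro.{u, v, w} C} (f : PreHom X Y) (g : PreHom Y Z) : PreHom X Z where
  idx k := f.idx (g.idx k)
  hom k := f.hom (g.idx k) ≫ g.hom k
  compat {k k'} h := by
    obtain ⟨j, h₁, h₂, e⟩ := g.compat h
    obtain ⟨i₁, a₁, b₁, e₁⟩ := f.compat h₁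
    obtain ⟨i₂, a₂, b₂, e₂⟩ := f.compat h₂
    obtain ⟨m, m₁, m₂⟩ := exists_ge_ge i₁ i₂
    refine ⟨m, a₁.trans m₁, a₂.trans m₂, ?_⟩
    have E₁ : X.map a₁ ≫ f.hom (g.idx k) ≫ g.hom k = X.map b₁ ≫ f.hom j ≫ Y.map h₁ ≫ g.hom k := by
      rw [reassoc_of% e₁]
    have E₂ : X.map a₂ ≫ f.hom (g.idx k') ≫ g.hom k' ≫ Z.map h =
        X.map b₂ ≫ f.hom j ≫ Y.map h₁ ≫ g.hom k := by
      rw [reassoc_of% e₂, e]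
    rw [Category.assoc]
    exact (map_eq_of_le X E₁ m₁).trans (map_eq_of_le X E₂ m₂).symm

theorem PreHom.comp_rel {X Y Z : Pro.{u, v, w} C} {f f' : PreHom X Y} {g g' : PreHom Y Z}
    (hf : f.Rel f') (hg : g.Rel g') : (f.comp g).Rel (f'.comp g') := fun k => by
  obtain ⟨j, h₁, h₂, e⟩ := hg k
  obtain ⟨i₀, a₀, b₀, e₀⟩ := hf j
  obtain ⟨i₁, a₁, b₁, e₁⟩ := f.compat h₁
  obtain ⟨i₂, a₂, b₂, e₂⟩ := f'.compat h₂
  obtain ⟨m', m₁, m₂⟩ := exists_ge_ge i₁ i₂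
  obtain ⟨m, mm, m₀⟩ := exists_ge_ge m' i₀
  refine ⟨m, a₁.trans (m₁.trans mm), a₂.trans (m₂.trans mm), ?_⟩
  have E₀ : X.map a₀ ≫ f.hom j ≫ Y.map h₁ ≫ g.hom k =
      X.map b₀ ≫ f'.hom j ≫ Y.map h₁ ≫ g.hom k := by
    rw [reassoc_of% e₀]
  have E₁ : X.map a₁ ≫ f.hom (g.idx k) ≫ g.hom k = X.map b₁ ≫ f.hom j ≫ Y.map h₁ ≫ g.hom k := by
    rw [reassoc_of% e₁]
  have E₂ : X.map a₂ ≫ f'.hom (g'.idx k) ≫ g'.hom k =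
      X.map b₂ ≫ f'.hom j ≫ Y.map h₁ ≫ g.hom k := by
    rw [reassoc_of% e₂, e]
  exact (map_eq_of_le X E₁ (m₁.trans mm)).trans ((map_eq_of_le X E₀ m₀).trans
    (map_eq_of_le X E₂ (m₂.trans mm)).symm)

/-- The category of pro-objects. -/
instance : Category (Pro.{u, v, w} C) where
  Hom X Y := _root_.Quotient (PreHom.setoid X Y)
  id X := ⟦PreHom.id X⟧
  comp f g := _root_.Quotient.map₂ PreHom.comp (fun _ _ h _ _ h' => PreHom.comp_rel h h') f g
  id_comp f := by
    induction f using _root_.Quotient.inductionOn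
    exact _root_.Quotient.sound (PreHom.Rel.of_eq (fun _ => rfl) fun j => by
      simp [PreHom.comp, PreHom.id, Pro.map_refl])
  comp_id f := by
    induction f using _root_.Quotient.inductionOn
    exact _root_.Quotient.sound (PreHom.Rel.of_eq (fun _ => rfl) fun j => by
      simp [PreHom.comp, PreHom.id, Pro.map_refl])
  assoc f g h := by
    induction f using _root_.Quotient.inductionOn
    induction g using _root_.Quotient.inductionOn
    induction h using _root_.Quotient.inductionOn
    exact _root_.Quotient.sound (PreHom.Rel.of_eq (fun _ => rfl) fun j => by
      simp [PreHom.comp, Pro.map_refl])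

/-- The morphism of pro-objects with a given representative. -/
def homMk {X Y : Pro.{u, v, w} C} (f : PreHom X Y) : X ⟶ Y := (⟦f⟧ : _root_.Quotient (PreHom.setoid X Y))

theorem homMk_surjective {X Y : Pro.{u, v, w} C} (f : X ⟶ Y) : ∃ g, homMk g = f :=
  _root_.Quotient.exists_rep f

theorem homMk_eq_iff {X Y : Pro.{u, v, w} C} {f g : PreHom X Y} : homMk f = homMk g ↔ f.Rel g :=
  _root_.Quotient.eq

theorem homMk_comp_homMk {X Y Z : Pro.{u, v, w} C} (f : PreHom X Y) (g : PreHom Y Z) :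
    homMk f ≫ homMk g = homMk (f.comp g) := rfl

/-- The pro-object given by an object. -/
def const : C ⥤ Pro.{u, v, w} C where
  obj A :=
    { Idx := PUnit
      obj := fun _ => A
      map := fun _ => 𝟙 A
      map_refl := fun _ => rfl
      map_trans := fun _ _ => (Category.id_comp _).symm }
  map f := homMk
    { idx := fun j => j
      hom := fun _ => f
      compat := fun _ => ⟨PUnit.unit, le_rfl, le_rfl, by simp⟩ }
  map_id A := rfl
  map_comp f g := rfl

/-- The extension of a functor to pro-objects. -/
def mapPro (G : C ⥤ D) : Pro.{u, v, w} C ⥤ Pro.{u, v, w} D where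
  obj X :=
    { Idx := X.Idx
      obj := fun i => G.obj (X.obj i)
      map := fun h => G.map (X.map h)
      map_refl := fun i => by rw [X.map_refl, G.map_id]
      map_trans := fun h h' => by rw [X.map_trans, G.map_comp] }
  map {X Y} f := _root_.Quotient.map (fun f =>
    { idx := f.idx
      hom := fun j => G.map (f.hom j)
      compat := fun h => by
        obtain ⟨i, h₁, h₂, e⟩ := f.compat h
        exact ⟨i, h₁, h₂, by simp only [← G.map_comp, e]⟩ }) (fun f g h j => by
        obtain ⟨i, h₁, h₂, e⟩ := h j
        exact ⟨i, h₁, h₂, by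
          change G.map _ ≫ G.map _ = G.map _ ≫ G.map _
          simp only [← G.map_comp, e]⟩) f
  map_id X := _root_.Quotient.sound (PreHom.Rel.of_eq (fun _ => rfl) fun j => by
      simp [PreHom.id, X.map_refl])
  map_comp f g := by
    induction f using _root_.Quotient.inductionOn
    induction g using _root_.Quotient.inductionOn
    exact _root_.Quotient.sound (PreHom.Rel.of_eq (fun _ => rfl) fun j => by
      simp [PreHom.comp, Pro.map_refl])

end Basic

section Coproducts

variable {C : Type u} [Category.{v} C] [HasFiniteCoproducts C]

instance : HasInitial (Pro.{u, v, w} C) := by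
  refine (IsInitial.ofUniqueHom (X := const.obj (⊥_ C))
    (fun Y => homMk
      { idx := fun _ => PUnit.unit
        hom := fun j => initial.to (Y.obj j)
        compat := fun _ => ⟨PUnit.unit, le_rfl, le_rfl, initial.hom_ext _ _⟩ }) ?_).hasInitial
  intro Y m
  obtain ⟨m, rfl⟩ := homMk_surjective m
  exact homMk_eq_iff.2 fun j => ⟨PUnit.unit, le_rfl, le_rfl, initial.hom_ext _ _⟩

/-- The coproduct of two pro-objects. -/
def coproduct (X Y : Pro.{u, v, w} C) : Pro.{u, v, w} C where
  Idx := X.Idx × Y.Idx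
  pre := inferInstanceAs (Preorder (X.Idx × Y.Idx))
  dir := ⟨fun a b => by
    obtain ⟨c, hc, hc'⟩ := exists_ge_ge a.1 b.1
    obtain ⟨d, hd, hd'⟩ := exists_ge_ge a.2 b.2
    exact ⟨(c, d), ⟨hc, hd⟩, ⟨hc', hd'⟩⟩⟩
  obj i := X.obj i.1 ⨿ Y.obj i.2
  map {i j} h := coprod.map (X.map (show i.1 ≤ j.1 from h.1)) (Y.map (show i.2 ≤ j.2 from h.2))
  map_refl i := by rw [X.map_refl, Y.map_refl, coprod.map_id_id]
  map_trans h h' := by rw [coprod.map_map, ← X.map_trans, ← Y.map_trans]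

/-- The first inclusion. -/
def coproductInl (X Y : Pro.{u, v, w} C) : PreHom X (coproduct X Y) where
  idx i := i.1
  hom i := coprod.inl
  compat {i j} h := ⟨j.1, h.1, le_rfl, by simp [coproduct, X.map_refl]⟩

/-- The second inclusion. -/
def coproductInr (X Y : Pro.{u, v, w} C) : PreHom Y (coproduct X Y) where
  idx i := i.2
  hom i := coprod.inr
  compat {i j} h := ⟨j.2, h.2, le_rfl, by simp [coproduct, Y.map_refl]⟩

/-- The morphism out of the coproduct with given components. -/
def coproductDesc {X Y Z : Pro.{u, v, w} C} (f : PreHom X Z) (g : PreHom Y Z) :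
    PreHom (coproduct X Y) Z where
  idx k := (f.idx k, g.idx k)
  hom k := coprod.desc (f.hom k) (g.hom k)
  compat {k k'} h := by
    obtain ⟨i, h₁, h₂, e⟩ := f.compat h
    obtain ⟨j, h₁', h₂', e'⟩ := g.compat h
    refine ⟨(i, j), ⟨h₁, h₁'⟩, ⟨h₂, h₂'⟩, ?_⟩
    simp only [coproduct, coprod.map_desc, coprod.desc_comp, e, e']

theorem existsUnique_desc {X Y Z : Pro.{u, v, w} C} (f : X ⟶ Z) (g : Y ⟶ Z) :
    ∃! h : coproduct X Y ⟶ Z, homMk (coproductInl X Y) ≫ h = f ∧ homMk (coproductInr X Y) ≫ h = g := by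
  obtain ⟨f, rfl⟩ := homMk_surjective f
  obtain ⟨g, rfl⟩ := homMk_surjective g
  refine ⟨homMk (coproductDesc f g), ⟨?_, ?_⟩, ?_⟩
  · exact homMk_eq_iff.2 (PreHom.Rel.of_eq (fun _ => rfl) fun k => by
      simp [PreHom.comp, coproductInl, coproductDesc, X.map_refl]
      exact coprod.inl_desc _ _)
  · exact homMk_eq_iff.2 (PreHom.Rel.of_eq (fun _ => rfl) fun k => by
      simp [PreHom.comp, coproductInr, coproductDesc, Y.map_refl]
      exact coprod.inr_desc _ _)
  · rintro h ⟨h1, h2⟩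
    obtain ⟨h, rfl⟩ := homMk_surjective h
    rw [homMk_comp_homMk, homMk_eq_iff] at h1 h2
    refine homMk_eq_iff.2 fun k => ?_
    obtain ⟨i, a, b, e⟩ := h1 k
    obtain ⟨j, a', b', e'⟩ := h2 k
    refine ⟨(i, j), ⟨a, a'⟩, ⟨b, b'⟩, ?_⟩
    simp only [PreHom.comp, coproductInl, coproductInr] at e e'
    refine coprod.hom_ext ?_ ?_
    · simp only [coproduct, coproductDesc, coprod.map_desc]
      rw [coprod.inl_map_assoc]
      exact Eq.trans e (coprod.inl_desc _ _).symm
    · simp only [coproduct, coproductDesc, coprod.map_desc]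
      rw [coprod.inr_map_assoc]
      exact Eq.trans e' (coprod.inr_desc _ _).symm

instance : HasBinaryCoproducts (Pro.{u, v, w} C) := by
  have : ∀ {X Y : Pro.{u, v, w} C}, HasColimit (pair X Y) := fun {X Y} =>
    ⟨⟨⟨BinaryCofan.mk (homMk (coproductInl X Y)) (homMk (coproductInr X Y)),
      BinaryCofan.IsColimit.mk _ (fun f g => (existsUnique_desc f g).choose)
        (fun f g => (existsUnique_desc f g).choose_spec.1.1)
        (fun f g => (existsUnique_desc f g).choose_spec.1.2)
        (fun f g m h1 h2 => (existsUnique_desc f g).choose_spec.2 m ⟨h1, h2⟩)⟩⟩⟩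
  exact hasBinaryCoproducts_of_hasColimit_pair _

instance : HasFiniteCoproducts (Pro.{u, v, w} C) := hasFiniteCoproducts_of_has_binary_and_initial

end Coproducts

end Pro

/-! ### Cocommutative cogroups -/

/-- A cocommutative cogroup structure on an object `X` of a category with finite coproducts. -/
structure CocommCogroup {C : Type u} [Category.{v} C] [HasFiniteCoproducts C] (X : C) where
  /-- The comultiplication. -/
  comul : X ⟶ X ⨿ X
  /-- The counit. -/
  counit : X ⟶ ⊥_ C
  /-- The inversion. -/
  inv : X ⟶ X
  counit_left : comul ≫ coprod.desc (counit ≫ initial.to X) (𝟙 X) = 𝟙 X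
  counit_right : comul ≫ coprod.desc (𝟙 X) (counit ≫ initial.to X) = 𝟙 X
  coassoc : comul ≫ coprod.map comul (𝟙 X) ≫ (coprod.associator X X X).hom =
    comul ≫ coprod.map (𝟙 X) comul
  inv_left : comul ≫ coprod.desc inv (𝟙 X) = counit ≫ initial.to X
  inv_right : comul ≫ coprod.desc (𝟙 X) inv = counit ≫ initial.to X
  cocomm : comul ≫ (coprod.braiding X X).hom = comul

namespace CocommCogroup

variable {C : Type u} [Category.{v} C] [HasFiniteCoproducts C] {X : C} (S : CocommCogroup X)

/-- The sum of two morphisms out of a cogroup. -/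
def addHom {Y : C} (f g : X ⟶ Y) : X ⟶ Y := S.comul ≫ coprod.desc f g

theorem addHom_comp {Y Z : C} (f g : X ⟶ Y) (h : Y ⟶ Z) :
    S.addHom f g ≫ h = S.addHom (f ≫ h) (g ≫ h) := by
  simp [addHom, coprod.desc_comp]

theorem addHom_assoc {Y : C} (f g h : X ⟶ Y) :
    S.addHom (S.addHom f g) h = S.addHom f (S.addHom g h) := by
  have e₁ : S.addHom (S.addHom f g) h =
      (S.comul ≫ coprod.map S.comul (𝟙 X) ≫ (coprod.associator X X X).hom) ≫
        coprod.desc f (coprod.desc g h) := by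
    simp only [addHom, Category.assoc]
    congr 1
    refine coprod.hom_ext ?_ ?_ <;>
      simp [coprod.inl_desc, coprod.inr_desc]
  have e₂ : S.addHom f (S.addHom g h) =
      (S.comul ≫ coprod.map (𝟙 X) S.comul) ≫ coprod.desc f (coprod.desc g h) := by
    simp [addHom]
  rw [e₁, e₂, S.coassoc]

theorem addHom_comm {Y : C} (f g : X ⟶ Y) : S.addHom f g = S.addHom g f := by
  have : S.addHom f g = (S.comul ≫ (coprod.braiding X X).hom) ≫ coprod.desc g f := by
    simp only [addHom, Category.assoc]
    congr 1
    refine coprod.hom_ext ?_ ?_ <;>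
      simp [coprod.inl_desc, coprod.inr_desc]
  rw [this, S.cocomm]
  rfl

/-- The zero morphism out of a cogroup. -/
def zeroHom (Y : C) : X ⟶ Y := S.counit ≫ initial.to Y

theorem zeroHom_addHom {Y : C} (f : X ⟶ Y) : S.addHom (S.zeroHom Y) f = f := by
  have := S.addHom_comp (S.counit ≫ initial.to X) (𝟙 X) f
  rw [addHom, S.counit_left, Category.id_comp, Category.assoc,
    Subsingleton.elim (initial.to X ≫ f) (initial.to Y)] at this
  exact this.symm

theorem inv_addHom {Y : C} (f : X ⟶ Y) : S.addHom (S.inv ≫ f) f = S.zeroHom Y := by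
  have := S.addHom_comp S.inv (𝟙 X) f
  rw [addHom, S.inv_left, Category.id_comp, Category.assoc,
    Subsingleton.elim (initial.to X ≫ f) (initial.to Y)] at this
  exact this.symm

/-- The abelian group structure on `Hom(X, Y)` given by a cocommutative cogroup structure on `X`,
with `f + g = ∇ ∘ (f ⨿ g) ∘ comul`. -/
abbrev homGroup (Y : C) : AddCommGroup (X ⟶ Y) where
  add f g := S.addHom f g
  zero := S.zeroHom Y
  neg f := S.inv ≫ f
  nsmul := @nsmulRec _ ⟨S.zeroHom Y⟩ ⟨S.addHom⟩
  zsmul := @zsmulRec _ ⟨S.zeroHom Y⟩ ⟨S.addHom⟩ ⟨fun f => S.inv ≫ f⟩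
    (@nsmulRec _ ⟨S.zeroHom Y⟩ ⟨S.addHom⟩)
  add_assoc := S.addHom_assoc
  zero_add := S.zeroHom_addHom
  add_zero f := (S.addHom_comm f _).trans (S.zeroHom_addHom f)
  neg_add_cancel := S.inv_addHom
  add_comm := S.addHom_comm

/-- The functor `Hom(X, -)` to abelian groups represented by a cocommutative cogroup `X`. -/
def homFunctor : C ⥤ AddCommGrpCat.{v} where
  obj Y := @AddCommGrpCat.of (X ⟶ Y) (S.homGroup Y)
  map {Y Z} h :=
    letI := S.homGroup Y
    letI := S.homGroup Z
    AddCommGrpCat.ofHom (AddMonoidHom.mk' (fun f : X ⟶ Y => f ≫ h)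
      fun f g => S.addHom_comp f g h)
  map_id Y := by
    let := S.homGroup Y
    exact AddCommGrpCat.hom_ext (AddMonoidHom.ext fun f => Category.comp_id (f : X ⟶ Y))
  map_comp {Y Z W} h k := by
    let := S.homGroup Y
    let := S.homGroup W
    exact AddCommGrpCat.hom_ext (AddMonoidHom.ext fun f => (Category.assoc (f : X ⟶ Y) h k).symm)

end CocommCogroup

/-! ### Morphisms from an object to an ind-object -/

section IndHom

variable {J : Type w} [Preorder J] [IsDirectedOrder J] {C : Type u} [Category.{v} C]

/-- Two representatives of a morphism from an object to an ind-object are equivalent if they agree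
in a large enough object of the system. -/
def indHomSetoid (A : C) (X : J ⥤ C) : Setoid (Σ j, A ⟶ X.obj j) where
  r f g := ∃ (k : J) (h₁ : f.1 ≤ k) (h₂ : g.1 ≤ k),
    f.2 ≫ X.map (homOfLE h₁) = g.2 ≫ X.map (homOfLE h₂)
  iseqv :=
    { refl := fun f => ⟨f.1, le_rfl, le_rfl, rfl⟩
      symm := fun ⟨k, h₁, h₂, e⟩ => ⟨k, h₂, h₁, e.symm⟩
      trans := by
        rintro f g h ⟨k, h₁, h₂, e⟩ ⟨k', h₁', h₂', e'⟩
        obtain ⟨m, hm, hm'⟩ := exists_ge_ge k k'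
        refine ⟨m, h₁.trans hm, h₂'.trans hm', ?_⟩
        rw [← homOfLE_comp h₁ hm, ← homOfLE_comp h₂' hm', X.map_comp, X.map_comp, reassoc_of% e,
          ← reassoc_of% e', ← X.map_comp, ← X.map_comp]
        rfl }

/-- The set of morphisms from an object `A` to an ind-object `(X_j)_{j ∈ J}`, given by a system of
objects indexed by a directed set `J`: the direct limit of the sets `Hom(A, X_j)`. -/
def IndHom (A : C) (X : J ⥤ C) : Type (max w v) := _root_.Quotient (indHomSetoid A X)

namespace IndHom

/-- The class of a morphism `A ⟶ X_j`. -/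
def mk {A : C} {X : J ⥤ C} (j : J) (f : A ⟶ X.obj j) : IndHom A X :=
  _root_.Quotient.mk (indHomSetoid A X) ⟨j, f⟩

theorem mk_eq_iff {A : C} {X : J ⥤ C} {j j' : J} {f : A ⟶ X.obj j} {g : A ⟶ X.obj j'} :
    mk j f = mk j' g ↔ ∃ (k : J) (h₁ : j ≤ k) (h₂ : j' ≤ k),
      f ≫ X.map (homOfLE h₁) = g ≫ X.map (homOfLE h₂) :=
  _root_.Quotient.eq

theorem exists_rep {A : C} {X : J ⥤ C} (x : IndHom A X) : ∃ j f, mk j f = x := by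
  obtain ⟨⟨j, f⟩, rfl⟩ := _root_.Quotient.exists_rep x
  exact ⟨j, f, rfl⟩

/-- Composition with a morphism of systems. -/
def map {A : C} {X Y : J ⥤ C} (η : X ⟶ Y) : IndHom A X → IndHom A Y :=
  _root_.Quotient.map (fun f => ⟨f.1, f.2 ≫ η.app f.1⟩) (by
    rintro f g ⟨k, h₁, h₂, e⟩
    exact ⟨k, h₁, h₂, by
      simp only [Category.assoc, ← η.naturality]
      rw [reassoc_of% e]⟩)

theorem map_mk {A : C} {X Y : J ⥤ C} (η : X ⟶ Y) (j : J) (f : A ⟶ X.obj j) :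
    map η (mk j f) = mk j (f ≫ η.app j) := rfl

/-- Application of a functor. -/
def mapFunctor {D : Type u} [Category.{v} D] (G : C ⥤ D) {A : C} {X : J ⥤ C} :
    IndHom A X → IndHom (G.obj A) (X ⋙ G) :=
  _root_.Quotient.map (fun f => ⟨f.1, G.map f.2⟩) (by
    rintro f g ⟨k, h₁, h₂, e⟩
    exact ⟨k, h₁, h₂, by
      change G.map _ ≫ G.map _ = G.map _ ≫ G.map _
      rw [← G.map_comp, ← G.map_comp, e]⟩)

theorem mapFunctor_mk {D : Type u} [Category.{v} D] (G : C ⥤ D) {A : C} {X : J ⥤ C} (j : J)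
    (f : A ⟶ X.obj j) : mapFunctor G (mk j f) = mk (X := X ⋙ G) j (G.map f) := rfl

end IndHom

end IndHom

/-! ### Tensor products and matrix algebras -/

section Tensor

variable {F : Type u} [Field F]

/-- The tensor product of algebras, as a functor in both variables. -/
def tensor : NAlg F ⥤ NAlg F ⥤ NAlg F where
  obj A :=
    { obj := fun B => ⟨A.carrier ⊗[F] B.carrier⟩
      map := fun {B B'} (g : B.carrier →ₙₐ[F] B'.carrier) =>
        (tmap (NonUnitalAlgHom.id F A.carrier) g :
          A.carrier ⊗[F] B.carrier →ₙₐ[F] A.carrier ⊗[F] B'.carrier)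
      map_id := fun B => tensor_hom_ext (F := F) (A := A.carrier) (B := B.carrier)
        (C := A.carrier ⊗[F] B.carrier) fun _ _ => rfl
      map_comp := fun {B _ B''} _ _ => tensor_hom_ext (F := F) (A := A.carrier) (B := B.carrier)
        (C := A.carrier ⊗[F] B''.carrier) fun _ _ => rfl }
  map {A A'} (f : A.carrier →ₙₐ[F] A'.carrier) :=
    { app := fun B => (tmap f (NonUnitalAlgHom.id F B.carrier) :
        A.carrier ⊗[F] B.carrier →ₙₐ[F] A'.carrier ⊗[F] B.carrier)
      naturality := fun B B' _ => tensor_hom_ext (F := F) (A := A.carrier) (B := B.carrier)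
        (C := A'.carrier ⊗[F] B'.carrier) fun _ _ => rfl }
  map_id A := by
    ext B
    exact tensor_hom_ext (F := F) (A := A.carrier) (B := B.carrier)
        (C := A.carrier ⊗[F] B.carrier) fun _ _ => rfl
  map_comp {A _ A''} _ _ := by
    ext B
    exact tensor_hom_ext (F := F) (A := A.carrier) (B := B.carrier)
        (C := A''.carrier ⊗[F] B.carrier) fun _ _ => rfl

variable (F) in
/-- The ind-algebra `M_•(F)`: the matrix algebras `M_n(F)`, `n = 0, 1, 2, …`, with the transition
morphisms `M_m(F) → M_n(F)` that put a matrix into the upper left corner. -/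
def matSystem : ℕ ⥤ NAlg F where
  obj n := ⟨Matrix (Fin n) (Fin n) F⟩
  map {m n} h := (corner F (Fin.castLEEmb (leOfHom h)) :
    Matrix (Fin m) (Fin m) F →ₙₐ[F] Matrix (Fin n) (Fin n) F)
  map_id _ := corner_refl
  map_comp {m _ _} h h' := NonUnitalAlgHom.ext fun M : Matrix (Fin m) (Fin m) F =>
    corner_trans (Fin.castLEEmb (leOfHom h)) (Fin.castLEEmb (leOfHom h')) M

/-- The ind-algebra `X ⊗ B`, for an ind-algebra `X` and an algebra `B`, as a functor of `B`. -/
def indTensor {J : Type w} [Preorder J] (X : J ⥤ NAlg F) : NAlg F ⥤ J ⥤ NAlg F :=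
  tensor.flip ⋙ (Functor.whiskeringLeft J (NAlg F) (NAlg F)).obj X

/-- The algebra `qA`. -/
def cuntz (A : NAlg F) : NAlg F := ⟨Cuntz F A.carrier⟩

variable (F) in
/-- The field `F` as an algebra. -/
def baseField : NAlg F := ⟨F⟩

/-- A pro-algebra `P` representing the functor `C ↦ Hom(A, X ⊗ C)` on algebras, for an algebra `A` and
an ind-algebra `X`. The pro-algebra representing this functor is denoted `𝔐ⁿᶜ(A, X)`. -/
structure ProRepresentation {J : Type w} [Preorder J] [IsDirectedOrder J] (A : NAlg F)
    (X : J ⥤ NAlg F) (P : Pro.{u + 1, u, v} (NAlg F)) where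
  /-- The bijections `Hom(P, C) ≅ Hom(A, X ⊗ C)`. -/
  equiv : ∀ C : NAlg F, (P ⟶ Pro.const.obj C) ≃ IndHom A ((indTensor X).obj C)
  natural : ∀ {C C' : NAlg F} (f : C ⟶ C') (φ : P ⟶ Pro.const.obj C),
    equiv C' (φ ≫ Pro.const.map f) = IndHom.map ((indTensor X).map f) (equiv C φ)

end Tensor

/-! ### The groups `𝔔𝔔(A, B) = [qA, M_•(B)]` -/

section QQ

variable {F : Type u} [Field F]

/-- The set `[qA, M_•(B)]` of morphisms from `qA` to the ind-algebra `M_•(B) = M_•(F) ⊗ B` in the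
category of ind-objects of the homotopy category. -/
def QQ (A B : NAlg F) : Type u :=
  IndHom ((toHot F).obj (cuntz A)) ((indTensor (matSystem F)).obj B ⋙ toHot F)

namespace QQ

variable {A B B' B'' : NAlg F}

/-- The class of a morphism `qA → M_n(B)`. -/
def cls (n : ℕ) (α : Cuntz F A.carrier →ₙₐ[F] Matrix (Fin n) (Fin n) F ⊗[F] B.carrier) :
    QQ A B :=
  IndHom.mk (A := (toHot F).obj (cuntz A)) (X := (indTensor (matSystem F)).obj B ⋙ toHot F) n
    ((toHot F).map (X := cuntz A) (Y := ((indTensor (matSystem F)).obj B).obj n) α)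

theorem exists_rep (x : QQ A B) : ∃ n α, cls n α = x := by
  obtain ⟨n, f, rfl⟩ := IndHom.exists_rep x
  obtain ⟨α, rfl⟩ := (toHot F).map_surjective (X := cuntz A)
    (Y := ((indTensor (matSystem F)).obj B).obj n) f
  exact ⟨n, α, rfl⟩

theorem cls_eq_iff {m n : ℕ}
    {α : Cuntz F A.carrier →ₙₐ[F] Matrix (Fin m) (Fin m) F ⊗[F] B.carrier}
    {β : Cuntz F A.carrier →ₙₐ[F] Matrix (Fin n) (Fin n) F ⊗[F] B.carrier} :
    cls m α = cls n β ↔ ∃ (k : ℕ) (h₁ : m ≤ k) (h₂ : n ≤ k),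
      Homotopic ((push F B.carrier (Fin.castLEEmb h₁)).comp α)
        ((push F B.carrier (Fin.castLEEmb h₂)).comp β) := by
  refine IndHom.mk_eq_iff.trans (exists_congr fun k => exists_congr fun h₁ =>
    exists_congr fun h₂ => ?_)
  exact toHot_map_eq_iff (A := cuntz A) (B := ((indTensor (matSystem F)).obj B).obj k)
    ((push F B.carrier (Fin.castLEEmb h₁)).comp α) ((push F B.carrier (Fin.castLEEmb h₂)).comp β)

theorem cls_eq_of_homotopic {n : ℕ}
    {α β : Cuntz F A.carrier →ₙₐ[F] Matrix (Fin n) (Fin n) F ⊗[F] B.carrier}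
    (h : Homotopic α β) : cls n α = cls n β :=
  cls_eq_iff.2 ⟨n, le_rfl, le_rfl, h.comp_left _⟩

/-- Extension by zero along any injection does not change the class. -/
theorem cls_push {m n : ℕ} (ρ : Fin m ↪ Fin n)
    (α : Cuntz F A.carrier →ₙₐ[F] Matrix (Fin m) (Fin m) F ⊗[F] B.carrier) :
    cls n ((push F B.carrier ρ).comp α) = cls m α := by
  have hmn : m ≤ n := by simpa using Fintype.card_le_of_embedding ρ
  refine cls_eq_iff.2 ⟨n + m, Nat.le_add_right _ _, Nat.le_add_left _ _, ?_⟩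
  have e : (push F B.carrier (Fin.castLEEmb (Nat.le_add_right n m))).comp
      ((push F B.carrier ρ).comp α) =
      (push F B.carrier (ρ.trans (Fin.castLEEmb (Nat.le_add_right n m)))).comp α := by
    rw [push_trans]
    rfl
  rw [e]
  have h₁ : ElemHomotopic (push F B.carrier (ρ.trans (Fin.castLEEmb (Nat.le_add_right n m))))
      (push F B.carrier (Fin.natAddEmb n)) :=
    push_homotopic_of_disjoint _ _ fun i j h => by
      have := congrArg Fin.val h
      simp at this
      omega
  have h₂ : ElemHomotopic (push F B.carrier (Fin.natAddEmb n))
      (push F B.carrier (Fin.castLEEmb (Nat.le_add_left m n))) :=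
    push_homotopic_of_disjoint _ _ fun i j h => by
      have := congrArg Fin.val h
      simp at this
      omega
  exact (Relation.ReflTransGen.single (h₁.comp_right α)).tail (h₂.comp_right α)

theorem castAdd_ne_natAdd {m n : ℕ} (i : Fin m) (j : Fin n) :
    Fin.castAddEmb n i ≠ Fin.natAddEmb m j := fun h => by
  have := congrArg Fin.val h
  simp at this
  omega

/-- The block sum `α ⊕ β : qA → M_{m+n}(B)` of `α : qA → M_m(B)` and `β : qA → M_n(B)`. -/
def blockSum {m n : ℕ} (α : Cuntz F A.carrier →ₙₐ[F] Matrix (Fin m) (Fin m) F ⊗[F] B.carrier)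
    (β : Cuntz F A.carrier →ₙₐ[F] Matrix (Fin n) (Fin n) F ⊗[F] B.carrier) :
    Cuntz F A.carrier →ₙₐ[F] Matrix (Fin (m + n)) (Fin (m + n)) F ⊗[F] B.carrier :=
  (blockHom F B.carrier (Fin.castAddEmb n) (Fin.natAddEmb m) castAdd_ne_natAdd).comp (α.prod β)

theorem blockSum_apply {m n : ℕ}
    (α : Cuntz F A.carrier →ₙₐ[F] Matrix (Fin m) (Fin m) F ⊗[F] B.carrier)
    (β : Cuntz F A.carrier →ₙₐ[F] Matrix (Fin n) (Fin n) F ⊗[F] B.carrier) (x : Cuntz F A.carrier) :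
    blockSum α β x = push F B.carrier (Fin.castAddEmb n) (α x) +
      push F B.carrier (Fin.natAddEmb m) (β x) := rfl

theorem push_push {l m n : ℕ} (σ : Fin l ↪ Fin m) (τ : Fin m ↪ Fin n)
    (x : Matrix (Fin l) (Fin l) F ⊗[F] B.carrier) :
    push F B.carrier τ (push F B.carrier σ x) = push F B.carrier (σ.trans τ) x := by
  rw [push_trans]
  rfl

theorem tmap_push {m n : ℕ} (σ : Fin m ↪ Fin n) (f : B.carrier →ₙₐ[F] B'.carrier)
    (x : Matrix (Fin m) (Fin m) F ⊗[F] B.carrier) :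
    tmap (NonUnitalAlgHom.id F _) f (push F B.carrier σ x) =
      push F B'.carrier σ (tmap (NonUnitalAlgHom.id F _) f x) := by
  rw [push, push, tmap_tmap, tmap_tmap]
  rfl

/-- Two injections with disjoint images, as one injection. -/
def joinEmb {m n N : ℕ} (σ : Fin m ↪ Fin N) (τ : Fin n ↪ Fin N) (h : ∀ i j, σ i ≠ τ j) :
    Fin (m + n) ↪ Fin N where
  toFun := Fin.addCases σ τ
  inj' i j := by
    refine Fin.addCases (fun i => ?_) (fun i => ?_) i <;>
      refine Fin.addCases (fun j => ?_) (fun j => ?_) j <;> simp [h, (h _ _).symm]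

/-- The class of a block sum does not depend on the positions of the blocks. -/
theorem cls_blockHom {m n N : ℕ} (σ : Fin m ↪ Fin N) (τ : Fin n ↪ Fin N) (h : ∀ i j, σ i ≠ τ j)
    (α : Cuntz F A.carrier →ₙₐ[F] Matrix (Fin m) (Fin m) F ⊗[F] B.carrier)
    (β : Cuntz F A.carrier →ₙₐ[F] Matrix (Fin n) (Fin n) F ⊗[F] B.carrier) :
    cls N ((blockHom F B.carrier σ τ h).comp (α.prod β)) = cls (m + n) (blockSum α β) := by
  rw [← cls_push (joinEmb σ τ h)]
  congr 1
  have h₁ : (Fin.castAddEmb n).trans (joinEmb σ τ h) = σ :=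
    Function.Embedding.ext fun i =>
      Fin.addCases_left (motive := fun _ => Fin N) (left := σ) (right := τ) i
  have h₂ : (Fin.natAddEmb m).trans (joinEmb σ τ h) = τ :=
    Function.Embedding.ext fun i =>
      Fin.addCases_right (motive := fun _ => Fin N) (left := σ) (right := τ) i
  ext x
  change push F B.carrier σ (α x) + push F B.carrier τ (β x) =
    push F B.carrier (joinEmb σ τ h) (blockSum α β x)
  rw [blockSum_apply, _root_.map_add, push_push, push_push, h₁, h₂]

theorem blockHom_homotopic {m n N : ℕ} (σ : Fin m ↪ Fin N) (τ : Fin n ↪ Fin N)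
    (h : ∀ i j, σ i ≠ τ j)
    {α α' : Cuntz F A.carrier →ₙₐ[F] Matrix (Fin m) (Fin m) F ⊗[F] B.carrier}
    {β β' : Cuntz F A.carrier →ₙₐ[F] Matrix (Fin n) (Fin n) F ⊗[F] B.carrier}
    (hα : Homotopic α α') (hβ : Homotopic β β') :
    Homotopic ((blockHom F B.carrier σ τ h).comp (α.prod β))
      ((blockHom F B.carrier σ τ h).comp (α'.prod β')) :=
  (hα.prod hβ).comp_left _

theorem cls_blockSum_push {m n k l : ℕ} (σ : Fin m ↪ Fin k) (τ : Fin n ↪ Fin l)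
    (α : Cuntz F A.carrier →ₙₐ[F] Matrix (Fin m) (Fin m) F ⊗[F] B.carrier)
    (β : Cuntz F A.carrier →ₙₐ[F] Matrix (Fin n) (Fin n) F ⊗[F] B.carrier) :
    cls (k + l) (blockSum ((push F B.carrier σ).comp α) ((push F B.carrier τ).comp β)) =
      cls (m + n) (blockSum α β) := by
  rw [← cls_blockHom (σ.trans (Fin.castAddEmb l)) (τ.trans (Fin.natAddEmb k))
    fun i j => castAdd_ne_natAdd _ _]
  congr 1
  ext x
  change _ = push F B.carrier (σ.trans (Fin.castAddEmb l)) (α x) +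
    push F B.carrier (τ.trans (Fin.natAddEmb k)) (β x)
  rw [push_trans, push_trans]
  rfl

theorem cls_blockSum_congr {m m' n n' : ℕ}
    {α : Cuntz F A.carrier →ₙₐ[F] Matrix (Fin m) (Fin m) F ⊗[F] B.carrier}
    {α' : Cuntz F A.carrier →ₙₐ[F] Matrix (Fin m') (Fin m') F ⊗[F] B.carrier}
    {β : Cuntz F A.carrier →ₙₐ[F] Matrix (Fin n) (Fin n) F ⊗[F] B.carrier}
    {β' : Cuntz F A.carrier →ₙₐ[F] Matrix (Fin n') (Fin n') F ⊗[F] B.carrier}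
    (hα : cls m α = cls m' α') (hβ : cls n β = cls n' β') :
    cls (m + n) (blockSum α β) = cls (m' + n') (blockSum α' β') := by
  obtain ⟨k, h₁, h₂, hα⟩ := cls_eq_iff.1 hα
  obtain ⟨l, h₃, h₄, hβ⟩ := cls_eq_iff.1 hβ
  rw [← cls_blockSum_push (Fin.castLEEmb h₁) (Fin.castLEEmb h₃),
    ← cls_blockSum_push (Fin.castLEEmb h₂) (Fin.castLEEmb h₄)]
  exact cls_eq_of_homotopic (blockHom_homotopic _ _ _ hα hβ)

/-- The size of a representative. -/
def size (x : QQ A B) : ℕ := (exists_rep x).choose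

/-- A representative. -/
def rep (x : QQ A B) :
    Cuntz F A.carrier →ₙₐ[F] Matrix (Fin x.size) (Fin x.size) F ⊗[F] B.carrier :=
  (exists_rep x).choose_spec.choose

theorem cls_rep (x : QQ A B) : cls x.size x.rep = x := (exists_rep x).choose_spec.choose_spec

/-- Addition is given by block sums, see `cls_add_cls`. -/
instance : Add (QQ A B) := ⟨fun x y => cls (x.size + y.size) (blockSum x.rep y.rep)⟩

/-- The neutral element is the class of the zero morphisms. -/
instance : Zero (QQ A B) := ⟨cls 0 0⟩

/-- The inverse is given by precomposition with the switch of `qA`, see `neg_cls`. -/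
instance : Neg (QQ A B) := ⟨fun x => cls x.size (x.rep.comp (switch F A.carrier))⟩

theorem cls_add_cls {m n : ℕ}
    (α : Cuntz F A.carrier →ₙₐ[F] Matrix (Fin m) (Fin m) F ⊗[F] B.carrier)
    (β : Cuntz F A.carrier →ₙₐ[F] Matrix (Fin n) (Fin n) F ⊗[F] B.carrier) :
    cls m α + cls n β = cls (m + n) (blockSum α β) :=
  cls_blockSum_congr (cls_rep _) (cls_rep _)

theorem comp_zero {C D E : Type*}
    [NonUnitalRing C] [Module F C] [IsScalarTower F C C] [SMulCommClass F C C]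
    [NonUnitalRing D] [Module F D] [IsScalarTower F D D] [SMulCommClass F D D]
    [NonUnitalRing E] [Module F E] [IsScalarTower F E E] [SMulCommClass F E E]
    (f : D →ₙₐ[F] E) : f.comp (0 : C →ₙₐ[F] D) = 0 :=
  NonUnitalAlgHom.ext fun _ => map_zero f

theorem cls_zero (n : ℕ) : cls n (0 : Cuntz F A.carrier →ₙₐ[F] _ ⊗[F] B.carrier) = 0 := by
  refine cls_eq_iff.2 ⟨n, le_rfl, Nat.zero_le n, ?_⟩
  rw [comp_zero, comp_zero]
  exact Relation.ReflTransGen.refl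

theorem neg_cls {n : ℕ}
    (α : Cuntz F A.carrier →ₙₐ[F] Matrix (Fin n) (Fin n) F ⊗[F] B.carrier) :
    - cls n α = cls n (α.comp (switch F A.carrier)) := by
  obtain ⟨k, h₁, h₂, h⟩ := cls_eq_iff.1 (cls_rep (cls n α))
  exact cls_eq_iff.2 ⟨k, h₁, h₂, h.comp_right (switch F A.carrier)⟩

theorem cls_switch_blockSum {n : ℕ}
    (α : Cuntz F A.carrier →ₙₐ[F] Matrix (Fin n) (Fin n) F ⊗[F] B.carrier) :
    cls (n + n) (blockSum (α.comp (switch F A.carrier)) α) = 0 := by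
  let ρ : Fin 2 × Fin n ↪ Fin (2 * n) := finProdFinEquiv.toEmbedding
  have hρ : ∀ i j, slice ρ 0 i ≠ slice ρ 1 j := fun i j h => by
    simpa using ρ.injective h
  rw [← cls_blockHom (slice ρ 0) (slice ρ 1) hρ, ← cls_zero (2 * n)]
  refine cls_eq_of_homotopic (Relation.ReflTransGen.single ?_)
  have e : (blockHom F B.carrier (slice ρ 0) (slice ρ 1) hρ).comp
      ((α.comp (switch F A.carrier)).prod α) =
      ((kappa (F := F) (B := B.carrier) ρ).comp (tmap (NonUnitalAlgHom.id F _) α)).comp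
        (switchDiag F A.carrier) := by
    ext x
    change push F B.carrier (slice ρ 0) (α (switch F A.carrier x)) +
      push F B.carrier (slice ρ 1) (α x) = _
    rw [← kappa_diagHom, ← kappa_diagHom]
    exact (map_add (kappa (F := F) (B := B.carrier) ρ) _ _).symm
  have := (switchDiag_elemHomotopic F A.carrier).comp_left
    ((kappa (F := F) (B := B.carrier) ρ).comp (tmap (NonUnitalAlgHom.id F _) α))
  rw [comp_zero] at this
  rw [e]
  exact this

instance : AddCommGroup (QQ A B) where
  add_assoc x y z := by
    obtain ⟨l, α, rfl⟩ := exists_rep x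
    obtain ⟨m, β, rfl⟩ := exists_rep y
    obtain ⟨n, γ, rfl⟩ := exists_rep z
    simp only [cls_add_cls]
    rw [← cls_push (finCongr (Nat.add_assoc l m n)).toEmbedding (blockSum (blockSum α β) γ)]
    congr 1
    ext x
    rw [NonUnitalAlgHom.comp_apply]
    simp only [blockSum_apply, _root_.map_add, push_push, add_assoc]
    congr 2
    congr 2
    ext i
    simp [Nat.add_assoc]
  zero_add x := by
    obtain ⟨n, α, rfl⟩ := exists_rep x
    change cls 0 0 + _ = _
    rw [cls_add_cls, ← cls_push (Fin.natAddEmb 0) α]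
    congr 1
    ext x
    refine (blockSum_apply _ _ _).trans ?_
    rw [NonUnitalAlgHom.zero_apply, map_zero]
    exact zero_add _
  add_zero x := by
    obtain ⟨n, α, rfl⟩ := exists_rep x
    change _ + cls 0 0 = _
    rw [cls_add_cls, ← cls_push (Fin.castAddEmb 0) α]
    congr 1
    ext x
    refine (blockSum_apply _ _ _).trans ?_
    rw [NonUnitalAlgHom.zero_apply, map_zero]
    exact add_zero _
  add_comm x y := by
    obtain ⟨m, α, rfl⟩ := exists_rep x
    obtain ⟨n, β, rfl⟩ := exists_rep y
    rw [cls_add_cls, cls_add_cls, ← cls_blockHom (Fin.natAddEmb n) (Fin.castAddEmb m)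
      (fun i j => (castAdd_ne_natAdd j i).symm)]
    congr 1
    ext x
    exact add_comm _ _
  neg_add_cancel x := by
    obtain ⟨n, α, rfl⟩ := exists_rep x
    rw [neg_cls, cls_add_cls, cls_switch_blockSum]
  nsmul := nsmulRec
  zsmul := zsmulRec

/-- The morphism `𝔔𝔔(A, B) → 𝔔𝔔(A, B')` induced by `f : B → B'`. -/
def map (f : B ⟶ B') : QQ A B → QQ A B' :=
  IndHom.map (Functor.whiskerRight ((indTensor (matSystem F)).map f) (toHot F))

theorem map_cls (f : B ⟶ B') {n : ℕ}
    (α : Cuntz F A.carrier →ₙₐ[F] Matrix (Fin n) (Fin n) F ⊗[F] B.carrier) :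
    map f (cls n α) = cls n ((tmap (NonUnitalAlgHom.id F _)
      (show B.carrier →ₙₐ[F] B'.carrier from f)).comp α) := rfl

theorem map_add (f : B ⟶ B') (x y : QQ A B) : map f (x + y) = map f x + map f y := by
  obtain ⟨m, α, rfl⟩ := exists_rep x
  obtain ⟨n, β, rfl⟩ := exists_rep y
  rw [cls_add_cls, map_cls, map_cls, map_cls, cls_add_cls]
  congr 1
  ext x
  rw [NonUnitalAlgHom.comp_apply, blockSum_apply, blockSum_apply, _root_.map_add, tmap_push, tmap_push]
  rfl

theorem map_id (x : QQ A B) : map (𝟙 B) x = x := by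
  obtain ⟨n, α, rfl⟩ := exists_rep x
  rw [map_cls]
  congr 1
  have : tmap (NonUnitalAlgHom.id F (Matrix (Fin n) (Fin n) F)) (NonUnitalAlgHom.id F B.carrier) =
      NonUnitalAlgHom.id F _ := tensor_hom_ext fun _ _ => rfl
  exact congrArg (fun h => NonUnitalAlgHom.comp h α) this

theorem map_comp (f : B ⟶ B') (g : B' ⟶ B'') (x : QQ A B) : map (f ≫ g) x = map g (map f x) := by
  obtain ⟨n, α, rfl⟩ := exists_rep x
  rw [map_cls, map_cls, map_cls]
  congr 1
  ext x
  exact (tmap_tmap F (NonUnitalAlgHom.id F (Matrix (Fin n) (Fin n) F))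
    (show B.carrier →ₙₐ[F] B'.carrier from f) (NonUnitalAlgHom.id F (Matrix (Fin n) (Fin n) F))
    (show B'.carrier →ₙₐ[F] B''.carrier from g) (α x)).symm

end QQ

/-- The functor `𝔔𝔔(A, -)` from algebras to abelian groups. -/
def QQFunctor (A : NAlg F) : NAlg F ⥤ AddCommGrpCat.{u} where
  obj B := AddCommGrpCat.of (QQ A B)
  map f := AddCommGrpCat.ofHom (AddMonoidHom.mk' (QQ.map f) (QQ.map_add f))
  map_id _ := AddCommGrpCat.hom_ext (AddMonoidHom.ext QQ.map_id)
  map_comp f g := AddCommGrpCat.hom_ext (AddMonoidHom.ext (QQ.map_comp f g))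

variable (F) in
/-- The functor `𝔔 = 𝔔𝔔(F, -)` from algebras to abelian groups. -/
def QFunctor : NAlg F ⥤ AddCommGrpCat.{u} := QQFunctor (baseField F)

end QQ

/-! ### Pro-algebras up to homotopy -/

section Classifying

variable {F : Type u} [Field F]

variable (F) in
/-- Pro-algebras. -/
abbrev ProAlg := Pro.{u + 1, u, u} (NAlg F)

variable (F) in
/-- Pro-objects of the homotopy category of algebras. -/
abbrev ProHot := Pro.{u + 1, u, u} (HotCat F)

variable (F) in
/-- The functor that regards a pro-algebra as a pro-object of the homotopy category. -/
abbrev proToHot : ProAlg F ⥤ ProHot F := Pro.mapPro (toHot F)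

/-- The functor `B ↦ [P, B]` from algebras to abelian groups, for a pro-algebra `P` with a cocommutative
cogroup structure in the category of pro-objects of the homotopy category. -/
def classesFunctor {P : ProAlg F} (S : CocommCogroup ((proToHot F).obj P)) :
    NAlg F ⥤ AddCommGrpCat.{u} :=
  Pro.const ⋙ proToHot F ⋙ S.homFunctor

/-- The class in `[P, B]` of a morphism of pro-algebras from `P` to the algebra `B`. -/
def proClass {P : ProAlg F} (S : CocommCogroup ((proToHot F).obj P)) {B : NAlg F}
    (φ : P ⟶ Pro.const.obj B) : (classesFunctor S).obj B :=
  show (proToHot F).obj P ⟶ (proToHot F).obj (Pro.const.obj B) from (proToHot F).map φ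

/-- The class in `𝔔𝔔(A, B) = [qA, M_•(B)]` of a morphism of ind-algebras `qA → M_•(B)`. -/
def indClass {A B : NAlg F} (ψ : IndHom (cuntz A) ((indTensor (matSystem F)).obj B)) :
    (QQFunctor A).obj B :=
  show QQ A B from IndHom.mapFunctor (toHot F) ψ

end Classifying

end ClassifyingPro

end

open ClassifyingPro

/-!
The theorem is an application of the Yoneda lemma, once homotopy is expressed through the functor that
a pro-algebra `P` represents.

*Existence.* For a finite-dimensional algebra `D` the functor `C ↦ Hom(A, D ⊗ C)` is corepresentable,
by the algebra `CoeffAlg` generated by the coordinates of a generic morphism out of `A`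
(`tensorCorepresentableBy`). For an inductive system `X` of such algebras, the corepresenting algebras
form an inverse system, which represents `C ↦ Hom(A, X ⊗ C)` (`corepProRepresentation`).

*Bijections.* Both `[P, B]` and `𝔔𝔔(A, B)` are quotients of `Hom(P, B) ≅ Hom(qA, M_•(B))`. The first
identification is generated by morphisms `P → B[x]` (`proToHot_map_eq_iff`), the second by morphisms
`qA → M_•(B)[x] ≅ M_•(B[x])` (`mapFunctor_toHot_eq_iff`). The representation, applied to the algebra
`B[x]`, turns the former into the latter (`proToHot_map_eq_iff_equiv`), so that
`[P, B] ≅ 𝔔𝔔(A, B)` (`classesEquiv`).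

*Cogroup structure.* The functor `𝔔𝔔(A, -)` factors through the homotopy category. A pro-object
`Y = (Y_j)` is the limit of the constant pro-objects `Y_j`, so `Hom(P, Y)` is the limit of the abelian
groups `[P, Y_j] ≅ 𝔔𝔔(A, Y_j)` (`Pro.homEquivLim`). Thus `Hom(P, -)` takes values in abelian groups on
all of `pro-Hot(Alg)`, which amounts to a cocommutative cogroup structure on `P`
(`CocommCogroup.ofNatural`), and on constant pro-objects its addition is that of `𝔔𝔔(A, -)`
(`Pro.addHom_cogroup`).
-/

noncomputable section

universe u v w

set_option linter.unusedSectionVars false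

namespace ClassifyingPro

/-! ### The universal algebra of coefficients of morphisms into a finite-dimensional extension -/

section Coordinates

variable {F : Type*} [Field F]
variable {D : Type*} [NonUnitalRing D] [Module F D] [IsScalarTower F D D] [SMulCommClass F D D]
variable {B C : Type*}
variable [NonUnitalRing B] [Module F B] [IsScalarTower F B B] [SMulCommClass F B B]
variable [NonUnitalRing C] [Module F C] [IsScalarTower F C C] [SMulCommClass F C C]
variable {ι : Type*} (b : Module.Basis ι F D)

variable (C) in
/-- The `i`-th coordinate `D ⊗ C → C` with respect to a basis `b` of `D`. -/
def tensorCoord (i : ι) : D ⊗[F] C →ₗ[F] C :=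
  (TensorProduct.lid F C).toLinearMap ∘ₗ (b.coord i).rTensor C

@[simp] theorem tensorCoord_tmul (i : ι) (d : D) (c : C) :
    tensorCoord C b i (d ⊗ₜ c) = b.repr d i • c := by
  simp [tensorCoord]

theorem tensorCoord_tmap (i : ι) (f : B →ₙₐ[F] C) (x : D ⊗[F] B) :
    tensorCoord C b i (tmap (NonUnitalAlgHom.id F D) f x) = f (tensorCoord B b i x) := by
  induction x with
  | zero => simp
  | add x y hx hy => simp only [map_add, hx, hy]
  | tmul d c => simp

variable [Fintype ι]

theorem sum_tmul_tensorCoord (x : D ⊗[F] C) : ∑ i, b i ⊗ₜ tensorCoord C b i x = x := by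
  induction x with
  | zero => simp
  | add x y hx hy => simp only [map_add, TensorProduct.tmul_add, Finset.sum_add_distrib, hx, hy]
  | tmul d c =>
    simp only [tensorCoord_tmul, ← TensorProduct.smul_tmul, ← TensorProduct.sum_tmul, b.sum_repr]

theorem tensorCoord_ext {x y : D ⊗[F] C} (h : ∀ i, tensorCoord C b i x = tensorCoord C b i y) :
    x = y := by
  rw [← sum_tmul_tensorCoord b x, ← sum_tmul_tensorCoord b y]
  simp only [h]

theorem tensorCoord_mul (k : ι) (x y : D ⊗[F] C) : tensorCoord C b k (x * y) =
    ∑ i, ∑ j, b.repr (b i * b j) k • (tensorCoord C b i x * tensorCoord C b j y) := by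
  conv_lhs => rw [← sum_tmul_tensorCoord b x, ← sum_tmul_tensorCoord b y]
  simp [Finset.sum_mul_sum]

end Coordinates

section CoeffAlg

variable {F : Type*} [Field F]
variable (A : Type*) [NonUnitalRing A] [Module F A] [IsScalarTower F A A] [SMulCommClass F A A]
variable {D : Type*} [NonUnitalRing D] [Module F D] [IsScalarTower F D D] [SMulCommClass F D D]
variable {C : Type*} [NonUnitalRing C] [Module F C] [IsScalarTower F C C] [SMulCommClass F C C]
variable {ι : Type*} [Fintype ι] (b : Module.Basis ι F D)

/-- The relations on symbols `x(a, i)` which make `a ↦ ∑ i, bᵢ ⊗ x(a, i)` a morphism of algebras. -/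
inductive CoeffRel : FreeAlgebra F (A × ι) → FreeAlgebra F (A × ι) → Prop
  | add (a a' : A) (i : ι) : CoeffRel (FreeAlgebra.ι F (a + a', i))
      (FreeAlgebra.ι F (a, i) + FreeAlgebra.ι F (a', i))
  | smul (t : F) (a : A) (i : ι) : CoeffRel (FreeAlgebra.ι F (t • a, i))
      (t • FreeAlgebra.ι F (a, i))
  | mul (a a' : A) (k : ι) : CoeffRel (FreeAlgebra.ι F (a * a', k))
      (∑ i, ∑ j, b.repr (b i * b j) k • (FreeAlgebra.ι F (a, i) * FreeAlgebra.ι F (a', j)))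

/-- The symbol `x(a, i)` in the unital algebra defined by the relations `CoeffRel`. -/
def coeffGen (x : A × ι) : RingQuot (CoeffRel A b) :=
  RingQuot.mkAlgHom F (CoeffRel A b) (FreeAlgebra.ι F x)

/-- The nonunital subalgebra generated by the symbols `x(a, i)`. -/
abbrev CoeffSub : NonUnitalSubalgebra F (RingQuot (CoeffRel A b)) :=
  NonUnitalAlgebra.adjoin F (Set.range (coeffGen A b))

/-- The nonunital algebra generated by symbols `x(a, i)` subject to the relations which make
`a ↦ ∑ i, bᵢ ⊗ x(a, i)` a morphism `A → D ⊗ CoeffAlg A b`. It is realized inside the unital algebra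
with the same presentation. -/
def CoeffAlg : Type _ := CoeffSub A b

instance : NonUnitalRing (CoeffAlg A b) := inferInstanceAs (NonUnitalRing (CoeffSub A b))
instance : Module F (CoeffAlg A b) := inferInstanceAs (Module F (CoeffSub A b))
instance : IsScalarTower F (CoeffAlg A b) (CoeffAlg A b) :=
  inferInstanceAs (IsScalarTower F (CoeffSub A b) (CoeffSub A b))
instance : SMulCommClass F (CoeffAlg A b) (CoeffAlg A b) :=
  inferInstanceAs (SMulCommClass F (CoeffSub A b) (CoeffSub A b))

namespace CoeffAlg

/-- The inclusion of `CoeffAlg A b` into its unital envelope. -/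
def val : CoeffAlg A b →ₙₐ[F] RingQuot (CoeffRel A b) where
  toFun x := Subtype.val x
  map_smul' _ _ := rfl
  map_zero' := rfl
  map_add' _ _ := rfl
  map_mul' _ _ := rfl

variable {A}

theorem val_injective : Function.Injective (val A b) := Subtype.val_injective

/-- The generator `x(a, i)` of `CoeffAlg A b`. -/
def gen (a : A) (i : ι) : CoeffAlg A b :=
  (⟨coeffGen A b (a, i), NonUnitalAlgebra.subset_adjoin F ⟨_, rfl⟩⟩ : CoeffSub A b)

theorem val_gen (a : A) (i : ι) : val A b (gen b a i) =
    RingQuot.mkAlgHom F (CoeffRel A b) (FreeAlgebra.ι F (a, i)) := rfl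

theorem gen_add (a a' : A) (i : ι) : gen b (a + a') i = gen b a i + gen b a' i :=
  val_injective b <| by
    simpa [val_gen] using RingQuot.mkAlgHom_rel F (CoeffRel.add (b := b) a a' i)

theorem gen_smul (t : F) (a : A) (i : ι) : gen b (t • a) i = t • gen b a i :=
  val_injective b <| by
    simpa [val_gen] using RingQuot.mkAlgHom_rel F (CoeffRel.smul (b := b) t a i)

theorem gen_mul (a a' : A) (k : ι) : gen b (a * a') k =
    ∑ i, ∑ j, b.repr (b i * b j) k • (gen b a i * gen b a' j) :=
  val_injective b <| by
    simpa [val_gen] using RingQuot.mkAlgHom_rel F (CoeffRel.mul (b := b) a a' k)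

/-- The linear map underlying `CoeffAlg.univ`. -/
def univLinear : A →ₗ[F] D ⊗[F] CoeffAlg A b where
  toFun a := ∑ i, b i ⊗ₜ gen b a i
  map_add' a a' := by simp only [gen_add, TensorProduct.tmul_add, Finset.sum_add_distrib]
  map_smul' t a := by
    simp only [gen_smul, TensorProduct.tmul_smul, Finset.smul_sum, RingHom.id_apply]

theorem tensorCoord_univLinear (a : A) (i : ι) :
    tensorCoord _ b i (univLinear b a) = gen b a i := by
  classical
  simp [univLinear, Finsupp.single_apply, ite_smul]

/-- The universal morphism `A → D ⊗ CoeffAlg A b`, `a ↦ ∑ i, bᵢ ⊗ x(a, i)`. -/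
def univ : A →ₙₐ[F] D ⊗[F] CoeffAlg A b :=
  ofLinear (univLinear b) fun a a' => by
    refine tensorCoord_ext b fun k => ?_
    simp only [tensorCoord_mul, tensorCoord_univLinear, gen_mul]

theorem tensorCoord_univ (a : A) (i : ι) : tensorCoord _ b i (univ b a) = gen b a i :=
  tensorCoord_univLinear b a i

variable {b}

theorem hom_ext {f g : CoeffAlg A b →ₙₐ[F] C} (h : ∀ a i, f (gen b a i) = g (gen b a i)) :
    f = g := by
  refine NonUnitalAlgHom.ext ?_
  rintro ⟨x, hx⟩
  induction hx using NonUnitalAlgebra.adjoin_induction with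
  | mem x hx =>
    obtain ⟨⟨a, i⟩, rfl⟩ := hx
    exact h a i
  | add x y hx' hy' hx hy =>
    let x' : CoeffAlg A b := (⟨x, hx'⟩ : CoeffSub A b)
    let y' : CoeffAlg A b := (⟨y, hy'⟩ : CoeffSub A b)
    exact (map_add f x' y').trans ((congrArg₂ (· + ·) hx hy).trans (map_add g x' y').symm)
  | zero => exact (map_zero f).trans (map_zero g).symm
  | mul x y hx' hy' hx hy =>
    let x' : CoeffAlg A b := (⟨x, hx'⟩ : CoeffSub A b)
    let y' : CoeffAlg A b := (⟨y, hy'⟩ : CoeffSub A b)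
    exact (map_mul f x' y').trans ((congrArg₂ (· * ·) hx hy).trans (map_mul g x' y').symm)
  | smul t x hx' hx =>
    let x' : CoeffAlg A b := (⟨x, hx'⟩ : CoeffSub A b)
    exact (map_smul f t x').trans ((congrArg (t • ·) hx).trans (map_smul g t x').symm)

/-- The extension to unital envelopes of the morphism `CoeffAlg A b → C` classifying `α`. -/
def coeffLift (α : A →ₙₐ[F] D ⊗[F] C) : RingQuot (CoeffRel A b) →ₐ[F] Unitization F C :=
  RingQuot.liftAlgHom F ⟨FreeAlgebra.lift F
    fun x => Unitization.inrNonUnitalAlgHom F C (tensorCoord C b x.2 (α x.1)), by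
      rintro _ _ (_ | _ | _)
      · simp
      · simp
      · simp only [FreeAlgebra.lift_ι_apply, map_mul, tensorCoord_mul, map_sum, map_smul]⟩

theorem coeffLift_gen (α : A →ₙₐ[F] D ⊗[F] C) (a : A) (i : ι) :
    coeffLift α (coeffGen A b (a, i)) = Unitization.inr (tensorCoord C b i (α a)) := by
  simp [coeffLift, coeffGen]

theorem coeffLift_fst (α : A →ₙₐ[F] D ⊗[F] C) (x : CoeffAlg A b) :
    (coeffLift α (val A b x)).fst = 0 := by
  obtain ⟨y, hy⟩ : ∃ y, y = val A b x := ⟨_, rfl⟩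
  have hx : y ∈ CoeffSub A b := hy ▸ x.2
  rw [← hy]
  clear hy
  induction hx using NonUnitalAlgebra.adjoin_induction with
  | mem x hx =>
    obtain ⟨⟨a, i⟩, rfl⟩ := hx
    simp [coeffLift_gen]
  | add x y _ _ hx hy => simp [hx, hy]
  | zero => simp
  | mul x y _ _ hx hy => simp [hx, hy]
  | smul t x _ hx => simp [hx]

/-- The morphism `CoeffAlg A b → C` whose values on the generators are the coordinates of a morphism
`A → D ⊗ C`. -/
def desc (α : A →ₙₐ[F] D ⊗[F] C) : CoeffAlg A b →ₙₐ[F] C where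
  toFun x := (coeffLift α (val A b x)).snd
  map_smul' t x := by simp
  map_zero' := by simp
  map_add' x y := by simp
  map_mul' x y := by simp [coeffLift_fst]

theorem desc_gen (α : A →ₙₐ[F] D ⊗[F] C) (a : A) (i : ι) :
    desc α (gen b a i) = tensorCoord C b i (α a) :=
  congrArg (fun z : Unitization F C => z.snd) (coeffLift_gen α a i)

theorem tensorCoord_tmap_univ (f : CoeffAlg A b →ₙₐ[F] C) (a : A) (i : ι) :
    tensorCoord C b i (tmap (NonUnitalAlgHom.id F D) f (univ b a)) = f (gen b a i) := by
  rw [tensorCoord_tmap, tensorCoord_univ]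

end CoeffAlg

end CoeffAlg

section Corepresentable

variable {F : Type u} [Field F]

/-- For a finite-dimensional algebra `D`, the functor `C ↦ Hom(A, D ⊗ C)` is corepresentable. -/
def tensorCorepresentableBy (A D : NAlg F) {ι : Type} [Fintype ι]
    (b : Module.Basis ι F D.carrier) :
    (tensor.obj D ⋙ coyoneda.obj (Opposite.op A)).CorepresentableBy ⟨CoeffAlg A.carrier b⟩ where
  homEquiv {C} :=
    { toFun := fun f : CoeffAlg A.carrier b →ₙₐ[F] C.carrier =>
        (tmap (NonUnitalAlgHom.id F D.carrier) f).comp (CoeffAlg.univ b)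
      invFun := fun α : A.carrier →ₙₐ[F] D.carrier ⊗[F] C.carrier => CoeffAlg.desc α
      left_inv := fun _f => CoeffAlg.hom_ext (C := C.carrier) fun a i =>
        (CoeffAlg.desc_gen _ a i).trans (CoeffAlg.tensorCoord_tmap_univ _ a i)
      right_inv := fun _α => NonUnitalAlgHom.ext fun a => tensorCoord_ext b fun i =>
        (CoeffAlg.tensorCoord_tmap_univ _ a i).trans (CoeffAlg.desc_gen _ a i) }
  homEquiv_comp {C C'} g f := NonUnitalAlgHom.ext fun a =>
    (tmap_tmap F (NonUnitalAlgHom.id F D.carrier)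
      (show CoeffAlg A.carrier b →ₙₐ[F] C.carrier from f) (NonUnitalAlgHom.id F D.carrier)
      (show C.carrier →ₙₐ[F] C'.carrier from g) (CoeffAlg.univ b a)).symm

end Corepresentable

/-! ### Morphisms from pro-objects to objects -/

/-- Two quotients of a set with the same kernel are in bijection. -/
def equivOfKernelEq {S A B : Type*} {p : S → A} {q : S → B} (hp : Function.Surjective p)
    (hq : Function.Surjective q) (h : ∀ s t, p s = p t ↔ q s = q t) : A ≃ B :=
  Equiv.ofBijective (fun a => q (Function.surjInv hp a))
    ⟨fun a a' e => by
      rw [← Function.surjInv_eq hp a, ← Function.surjInv_eq hp a']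
      exact (h _ _).2 e,
    fun b => by
      obtain ⟨s, rfl⟩ := hq b
      exact ⟨p s, (h _ _).1 (Function.surjInv_eq hp _)⟩⟩

theorem equivOfKernelEq_apply {S A B : Type*} {p : S → A} {q : S → B}
    (hp : Function.Surjective p) (hq : Function.Surjective q) (h : ∀ s t, p s = p t ↔ q s = q t)
    (s : S) : equivOfKernelEq hp hq h (p s) = q s :=
  (h _ _).1 (Function.surjInv_eq hp _)

namespace Pro

variable {C : Type u} [Category.{v} C]

/-- The morphism from a pro-object to a constant pro-object represented by `X_i ⟶ E`. -/
def toConst (X : Pro.{u, v, w} C) {E : C} (i : X.Idx) (f : X.obj i ⟶ E) : X ⟶ const.obj E :=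
  homMk
    { idx := fun _ => i
      hom := fun _ => f
      compat := fun _ => ⟨i, le_rfl, le_rfl, congrArg _ (Category.comp_id f).symm⟩ }

theorem toConst_eq_iff {X : Pro.{u, v, w} C} {E : C} {i j : X.Idx} {f : X.obj i ⟶ E}
    {g : X.obj j ⟶ E} : toConst X i f = toConst X j g ↔
      ∃ (k : X.Idx) (h₁ : i ≤ k) (h₂ : j ≤ k), X.map h₁ ≫ f = X.map h₂ ≫ g :=
  homMk_eq_iff.trans ⟨fun h => h PUnit.unit, fun h _ => h⟩

theorem exists_toConst {X : Pro.{u, v, w} C} {E : C} (φ : X ⟶ const.obj E) :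
    ∃ i f, toConst X i f = φ := by
  obtain ⟨f, rfl⟩ := homMk_surjective φ
  exact ⟨f.idx PUnit.unit, f.hom PUnit.unit, rfl⟩

theorem toConst_comp (X : Pro.{u, v, w} C) {E E' : C} (i : X.Idx) (f : X.obj i ⟶ E)
    (g : E ⟶ E') : toConst X i f ≫ const.map g = toConst X i (f ≫ g) := rfl

theorem toConst_map (X : Pro.{u, v, w} C) {E : C} {i j : X.Idx} (h : i ≤ j) (f : X.obj i ⟶ E) :
    toConst X j (X.map h ≫ f) = toConst X i f :=
  toConst_eq_iff.2 ⟨j, le_rfl, h, by rw [X.map_refl, Category.id_comp]⟩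

/-- The projection of a pro-object to its `j`-th object. -/
def proj (Y : Pro.{u, v, w} C) (j : Y.Idx) : Y ⟶ const.obj (Y.obj j) := toConst Y j (𝟙 _)

theorem homMk_comp_proj {X Y : Pro.{u, v, w} C} (f : PreHom X Y) (j : Y.Idx) :
    homMk f ≫ proj Y j = toConst X (f.idx j) (f.hom j) :=
  congrArg (toConst X (f.idx j)) (Category.comp_id (f.hom j))

theorem proj_comp_map (Y : Pro.{u, v, w} C) {j j' : Y.Idx} (h : j ≤ j') :
    proj Y j' ≫ const.map (Y.map h) = proj Y j := by
  rw [proj, toConst_comp, Category.id_comp, ← Category.comp_id (Y.map h), toConst_map]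
  rfl

theorem hom_ext_proj {X Y : Pro.{u, v, w} C} {f g : X ⟶ Y}
    (h : ∀ j, f ≫ proj Y j = g ≫ proj Y j) : f = g := by
  obtain ⟨f, rfl⟩ := homMk_surjective f
  obtain ⟨g, rfl⟩ := homMk_surjective g
  simp only [homMk_comp_proj] at h
  exact homMk_eq_iff.2 fun j => toConst_eq_iff.1 (h j)

/-- A pro-object is the limit of its objects in the category of pro-objects. -/
theorem exists_comp_proj_eq {X Y : Pro.{u, v, w} C} (x : ∀ j, X ⟶ const.obj (Y.obj j))
    (hx : ∀ {j j' : Y.Idx} (h : j ≤ j'), x j' ≫ const.map (Y.map h) = x j) :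
    ∃ f : X ⟶ Y, ∀ j, f ≫ proj Y j = x j := by
  choose i f hf using fun j => exists_toConst (x j)
  refine ⟨homMk ⟨i, f, fun {j j'} h => toConst_eq_iff.1 ?_⟩, fun j => ?_⟩
  · rw [hf, ← toConst_comp, hf, hx]
  · rw [homMk_comp_proj, hf]

theorem exists_comp_proj_eq_proj_comp {X Y : Pro.{u, v, w} C} (f : X ⟶ Y) (j : Y.Idx) :
    ∃ (i : X.Idx) (g : X.obj i ⟶ Y.obj j), f ≫ proj Y j = proj X i ≫ const.map g := by
  obtain ⟨f, rfl⟩ := homMk_surjective f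
  refine ⟨f.idx j, f.hom j, ?_⟩
  rw [homMk_comp_proj, proj, toConst_comp, Category.id_comp]

end Pro

/-! ### Pro-representability -/

section ProRepresentability

variable {F : Type u} [Field F] {J : Type w} [Preorder J] [IsDirectedOrder J]
variable {A : NAlg F} {X : J ⥤ NAlg F} {U : J → NAlg F}

/-- The transition morphism `U_{j'} ⟶ U_j`, for `j ≤ j'`, between the algebras which corepresent
`C ↦ Hom(A, X_{j'} ⊗ C)` and `C ↦ Hom(A, X_j ⊗ C)`. -/
def corepMap
    (r : ∀ j, (tensor.obj (X.obj j) ⋙ coyoneda.obj (Opposite.op A)).CorepresentableBy (U j))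
    {j j' : J} (h : j ≤ j') : U j' ⟶ U j :=
  (r j').homEquiv.symm ((r j).homEquiv (𝟙 _) ≫ (tensor.map (X.map (homOfLE h))).app (U j))

variable (r : ∀ j, (tensor.obj (X.obj j) ⋙ coyoneda.obj (Opposite.op A)).CorepresentableBy (U j))

theorem homEquiv_corepMap_comp {j j' : J} (h : j ≤ j') {C : NAlg F} (f : U j ⟶ C) :
    (r j').homEquiv (corepMap r h ≫ f) =
      (r j).homEquiv f ≫ (tensor.map (X.map (homOfLE h))).app C := by
  rw [(r j').homEquiv_comp, corepMap, Equiv.apply_symm_apply]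
  conv_rhs => rw [← Category.id_comp f, (r j).homEquiv_comp]
  change ((_ ≫ _) ≫ _ : A ⟶ _) = (_ ≫ _) ≫ _
  rw [Category.assoc, Category.assoc, NatTrans.naturality]

theorem corepMap_refl (j : J) : corepMap r (le_refl j) = 𝟙 (U j) := by
  refine (r j).homEquiv.injective ?_
  rw [← Category.comp_id (corepMap r _), homEquiv_corepMap_comp]
  have : X.map (homOfLE (le_refl j)) = 𝟙 _ := X.map_id j
  rw [this, tensor.map_id]
  exact Category.comp_id _

theorem corepMap_trans {i j k : J} (h : i ≤ j) (h' : j ≤ k) :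
    corepMap r (h.trans h') = corepMap r h' ≫ corepMap r h := by
  refine (r k).homEquiv.injective ?_
  rw [homEquiv_corepMap_comp, ← Category.comp_id (corepMap r (h.trans h')),
    ← Category.comp_id (corepMap r h), homEquiv_corepMap_comp, homEquiv_corepMap_comp,
    ← homOfLE_comp h h', X.map_comp, tensor.map_comp]
  exact (Category.assoc _ _ _).symm

variable [Nonempty J]

/-- The pro-algebra formed by algebras `U_j` which corepresent `C ↦ Hom(A, X_j ⊗ C)`. -/
def corepPro : Pro.{u + 1, u, max w v} (NAlg F) where
  Idx := ULift.{v} J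
  dir := ⟨fun a b => by
    obtain ⟨c, hc, hc'⟩ := exists_ge_ge a.down b.down
    exact ⟨⟨c⟩, hc, hc'⟩⟩
  obj j := U j.down
  map h := corepMap r h
  map_refl j := corepMap_refl r j.down
  map_trans h h' := corepMap_trans r h h'

theorem toConst_corepPro_eq_iff {C : NAlg F} (f g : Σ j, (U j ⟶ C)) :
    Pro.toConst (corepPro.{u, v} r) ⟨f.1⟩ f.2 = Pro.toConst (corepPro.{u, v} r) ⟨g.1⟩ g.2 ↔
      IndHom.mk (X := (indTensor X).obj C) f.1 ((r f.1).homEquiv f.2) =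
        IndHom.mk (X := (indTensor X).obj C) g.1 ((r g.1).homEquiv g.2) := by
  refine Pro.toConst_eq_iff.trans (Iff.trans ?_ IndHom.mk_eq_iff.symm)
  have key : ∀ {k : J} (h₁ : f.1 ≤ k) (h₂ : g.1 ≤ k),
      corepMap r h₁ ≫ f.2 = corepMap r h₂ ≫ g.2 ↔
        (r f.1).homEquiv f.2 ≫ (tensor.map (X.map (homOfLE h₁))).app C =
          (r g.1).homEquiv g.2 ≫ (tensor.map (X.map (homOfLE h₂))).app C := fun h₁ h₂ => by
    rw [← homEquiv_corepMap_comp, ← homEquiv_corepMap_comp, Equiv.apply_eq_iff_eq]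
  exact ⟨fun ⟨k, h₁, h₂, e⟩ => ⟨k.down, h₁, h₂, (key _ _).1 e⟩,
    fun ⟨k, h₁, h₂, e⟩ => ⟨⟨k⟩, h₁, h₂, (key _ _).2 e⟩⟩

/-- The pro-algebra `corepPro r` represents the functor `C ↦ Hom(A, X ⊗ C)`. -/
def corepProRepresentation : ProRepresentation A X (corepPro.{u, v} r) where
  equiv C := equivOfKernelEq (S := Σ j, (U j ⟶ C))
    (p := fun f => Pro.toConst (corepPro.{u, v} r) ⟨f.1⟩ f.2)
    (q := fun f => IndHom.mk (X := (indTensor X).obj C) f.1 ((r f.1).homEquiv f.2))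
    (fun φ => by
      obtain ⟨j, f, rfl⟩ := Pro.exists_toConst φ
      exact ⟨⟨j.down, f⟩, rfl⟩)
    (fun x => by
      obtain ⟨j, f, rfl⟩ := IndHom.exists_rep x
      exact ⟨⟨j, (r j).homEquiv.symm f⟩, congrArg _ ((r j).homEquiv.apply_symm_apply f)⟩)
    (toConst_corepPro_eq_iff r)
  natural {C C'} g φ := by
    obtain ⟨j, f, rfl⟩ := Pro.exists_toConst φ
    rw [Pro.toConst_comp]
    refine (equivOfKernelEq_apply (S := Σ j, (U j ⟶ C')) _ _ _ ⟨j.down, f ≫ g⟩).trans ?_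
    refine Eq.trans ?_ (congrArg _
      (equivOfKernelEq_apply (S := Σ j, (U j ⟶ C)) _ _ _ ⟨j.down, f⟩).symm)
    exact congrArg (IndHom.mk (X := (indTensor X).obj C') j.down) ((r j.down).homEquiv_comp g f)

end ProRepresentability

/-! ### Cogroups from natural group structures -/

section Cogroups

/-- A natural structure of an abelian group on the sets `Hom(X, Y)` comes from a cocommutative
cogroup structure on `X`: the comultiplication is the sum of the two inclusions `X ⟶ X ⨿ X`, the
counit is zero and the inversion is the negative of the identity. -/
def CocommCogroup.ofNatural {C : Type u} [Category.{v} C] [HasFiniteCoproducts C] {X : C}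
    [∀ Y : C, AddCommGroup (X ⟶ Y)]
    (add_comp : ∀ {Y Z : C} (f g : X ⟶ Y) (h : Y ⟶ Z), (f + g) ≫ h = f ≫ h + g ≫ h) :
    CocommCogroup X :=
  have zero_comp : ∀ {Y Z : C} (h : Y ⟶ Z), (0 : X ⟶ Y) ≫ h = 0 := fun h =>
    (AddMonoidHom.mk' (· ≫ h) fun f g => add_comp f g h).map_zero
  { comul := coprod.inl + coprod.inr
    counit := 0
    inv := -𝟙 X
    counit_left := by simp [add_comp, coprod.inl_desc, coprod.inr_desc, zero_comp]
    counit_right := by simp [add_comp, coprod.inl_desc, coprod.inr_desc, zero_comp]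
    coassoc := by simp [add_comp, coprod.inl_desc, coprod.inr_desc, add_assoc]
    inv_left := by simp [add_comp, coprod.inl_desc, coprod.inr_desc, zero_comp]
    inv_right := by simp [add_comp, coprod.inl_desc, coprod.inr_desc, zero_comp]
    cocomm := by simp [add_comp, coprod.inl_desc, coprod.inr_desc, add_comm] }

namespace Pro

variable {C : Type u} [Category.{v} C] {X : Pro.{u, v, w} C} {G : C ⥤ AddCommGrpCat.{v}}

/-- The limit of the groups `G(Y_j)`, for a pro-object `Y = (Y_j)`. -/
def limSubgroup (G : C ⥤ AddCommGrpCat.{v}) (Y : Pro.{u, v, w} C) :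
    AddSubgroup (∀ j, G.obj (Y.obj j)) where
  carrier := {x | ∀ (j j' : Y.Idx) (h : j ≤ j'), (G.map (Y.map h)).hom (x j') = x j}
  zero_mem' j j' h := map_zero _
  add_mem' {x y} hx hy j j' h := by
    rw [Pi.add_apply, Pi.add_apply, map_add, hx, hy]
  neg_mem' {x} hx j j' h := by
    rw [Pi.neg_apply, Pi.neg_apply, map_neg, hx]

variable (e : ∀ E : C, (X ⟶ const.obj E) ≃ G.obj E)
variable (he : ∀ {E E' : C} (f : X ⟶ const.obj E) (g : E ⟶ E'),
  e E' (f ≫ const.map g) = (G.map g).hom (e E f))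

/-- If `G` is represented by `X` on objects of `C`, then `Hom(X, Y)` is the limit of the groups
`G(Y_j)`. -/
def homEquivLim (Y : Pro.{u, v, w} C) : (X ⟶ Y) ≃ limSubgroup G Y :=
  Equiv.ofBijective (fun f => ⟨fun j => e _ (f ≫ proj Y j), fun j j' h => by
      rw [← he, Category.assoc, proj_comp_map]⟩)
    ⟨fun f g h => hom_ext_proj fun j => (e _).injective (congrFun (congrArg Subtype.val h) j),
    fun ⟨x, hx⟩ => by
      obtain ⟨f, hf⟩ := exists_comp_proj_eq (X := X) (Y := Y) (fun j => (e _).symm (x j))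
        fun {j j'} h => (e _).injective (by
          rw [he, Equiv.apply_symm_apply, Equiv.apply_symm_apply, hx])
      exact ⟨f, Subtype.ext (funext fun j => by simp [hf])⟩⟩

theorem homEquivLim_apply {Y : Pro.{u, v, w} C} (f : X ⟶ Y) (j : Y.Idx) :
    (homEquivLim e he Y f).1 j = e _ (f ≫ proj Y j) := rfl

/-- The group structure on `Hom(X, Y)` induced by a group structure on the functor which `X`
represents on objects of `C`. -/
abbrev homAddCommGroup (Y : Pro.{u, v, w} C) : AddCommGroup (X ⟶ Y) :=
  (homEquivLim e he Y).addCommGroup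

theorem add_comp_proj {Y : Pro.{u, v, w} C} (f g : X ⟶ Y) (j : Y.Idx) :
    letI := homAddCommGroup e he Y
    e _ ((f + g) ≫ proj Y j) = e _ (f ≫ proj Y j) + e _ (g ≫ proj Y j) := by
  let := homAddCommGroup e he Y
  have : homEquivLim e he Y (f + g) = homEquivLim e he Y f + homEquivLim e he Y g :=
    (homEquivLim e he Y).apply_symm_apply _
  rw [← homEquivLim_apply e he, this]
  rfl

theorem add_homComp {Y Z : Pro.{u, v, w} C} (f g : X ⟶ Y) (h : Y ⟶ Z) :
    letI := homAddCommGroup e he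
    (f + g) ≫ h = f ≫ h + g ≫ h := by
  let := homAddCommGroup e he
  refine hom_ext_proj fun k => (e _).injective ?_
  obtain ⟨i, a, ha⟩ := exists_comp_proj_eq_proj_comp h k
  rw [add_comp_proj e he, Category.assoc, Category.assoc, Category.assoc, ha,
    ← Category.assoc, ← Category.assoc, ← Category.assoc, he, he, he, add_comp_proj e he, map_add]

variable [HasFiniteCoproducts C]

/-- A pro-object `X` which represents, on objects of `C`, a functor to abelian groups is a
cocommutative cogroup. -/
def cogroup : CocommCogroup X :=
  letI := homAddCommGroup e he
  CocommCogroup.ofNatural (add_homComp e he)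

theorem addHom_cogroup {E : C} (f g : X ⟶ const.obj E) :
    e E ((cogroup e he).addHom f g) = e E f + e E g := by
  let := homAddCommGroup e he
  have h : (cogroup e he).addHom f g = f + g := by
    change (coprod.inl + coprod.inr : X ⟶ X ⨿ X) ≫ _ = _
    rw [add_homComp e he, coprod.inl_desc, coprod.inr_desc]
  -- The only projection of a constant pro-object is the identity.
  have h1 : ∀ φ : X ⟶ const.obj E, φ ≫ proj (const.obj E) PUnit.unit = φ := Category.comp_id
  have := add_comp_proj e he f g PUnit.unit
  rw [h1, h1, h1] at this
  exact (congrArg (e E) h).trans this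

end Pro

end Cogroups

/-! ### Homotopy classes of morphisms of pro-algebras and ind-algebras -/

section HomotopyClasses

variable {F : Type u} [Field F]

/-- The polynomial extension `B[x] = B ⊗ F[x]`. -/
def NAlg.poly (B : NAlg F) : NAlg F := ⟨B.carrier ⊗[F] F[X]⟩

/-- The evaluation `B[x] ⟶ B`, `x ↦ t`. -/
def NAlg.ev (B : NAlg F) (t : F) : B.poly ⟶ B :=
  (evalAt t : B.carrier ⊗[F] F[X] →ₙₐ[F] B.carrier)

theorem toHot_map_comp_ev {A B : NAlg F} (H : A ⟶ B.poly) :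
    (toHot F).map (H ≫ B.ev 0) = (toHot F).map (H ≫ B.ev 1) :=
  (toHot_map_eq_iff _ _).2 (Relation.ReflTransGen.single ⟨H, rfl, rfl⟩)

/-- There is a morphism `P → B[x]` of pro-algebras whose evaluations are `φ` and `ψ`. -/
def ProElemHomotopic {P : ProAlg F} {B : NAlg F} (φ ψ : P ⟶ Pro.const.obj B) : Prop :=
  ∃ H : P ⟶ Pro.const.obj B.poly,
    H ≫ Pro.const.map (B.ev 0) = φ ∧ H ≫ Pro.const.map (B.ev 1) = ψ

/-- The kernel of `Hom(P, B) → [P, B]` is generated by elementary homotopies. -/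
theorem proToHot_map_eq_iff {P : ProAlg F} {B : NAlg F} {φ ψ : P ⟶ Pro.const.obj B} :
    (proToHot F).map φ = (proToHot F).map ψ ↔ Relation.ReflTransGen ProElemHomotopic φ ψ := by
  constructor
  · -- The homotopy relation is imposed at a large enough index `k`, where each link of the chain of
    -- elementary homotopies is a morphism `P_k → B[x]`.
    obtain ⟨i, f, rfl⟩ := Pro.exists_toConst φ
    obtain ⟨j, g, rfl⟩ := Pro.exists_toConst ψ
    intro h
    obtain ⟨k, h₁, h₂, e⟩ := (Pro.toConst_eq_iff (X := (proToHot F).obj P)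
      (E := (toHot F).obj B) (f := (toHot F).map f) (g := (toHot F).map g)).1 h
    rw [← Pro.toConst_map P h₁ f, ← Pro.toConst_map P h₂ g]
    have e' : (toHot F).map (P.map h₁ ≫ f) = (toHot F).map (P.map h₂ ≫ g) :=
      ((toHot F).map_comp _ _).trans (e.trans ((toHot F).map_comp _ _).symm)
    refine Relation.ReflTransGen.lift (Pro.toConst P k) ?_ _ _ ((toHot_map_eq_iff _ _).1 e')
    rintro _ _ ⟨H, rfl, rfl⟩
    exact ⟨Pro.toConst P k H, rfl, rfl⟩
  · intro h
    induction h with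
    | refl => rfl
    | tail _ h ih =>
      refine ih.trans ?_
      obtain ⟨H, rfl, rfl⟩ := h
      obtain ⟨i, H, rfl⟩ := Pro.exists_toConst H
      exact congrArg (Pro.toConst ((proToHot F).obj P) i) (toHot_map_comp_ev H)

variable {J : Type w} [Preorder J] [IsDirectedOrder J] {A : NAlg F} {X : J ⥤ NAlg F}

/-- There is a morphism `A → X ⊗ B[x]` of ind-algebras whose evaluations are `x` and `y`. -/
def IndElemHomotopic {B : NAlg F} (x y : IndHom A ((indTensor X).obj B)) : Prop :=
  ∃ z : IndHom A ((indTensor X).obj B.poly),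
    IndHom.map ((indTensor X).map (B.ev 0)) z = x ∧ IndHom.map ((indTensor X).map (B.ev 1)) z = y

theorem IndHom.mk_map {C : Type u} [Category.{v} C] {A : C} {X : J ⥤ C} {j k : J} (h : j ≤ k)
    (f : A ⟶ X.obj j) : IndHom.mk k (f ≫ X.map (homOfLE h)) = IndHom.mk j f := by
  refine IndHom.mk_eq_iff.2 ⟨k, le_rfl, h, ?_⟩
  have : X.map (homOfLE (le_refl k)) = 𝟙 _ := X.map_id k
  rw [this, Category.comp_id]

/-- Under `D ⊗ B[x] ≅ (D ⊗ B)[x]`, the evaluations of `B[x]`, tensored with `D`, are those of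
`(D ⊗ B)[x]`. -/
theorem evalAt_assocInvHom {D B : Type*}
    [NonUnitalRing D] [Module F D] [IsScalarTower F D D] [SMulCommClass F D D]
    [NonUnitalRing B] [Module F B] [IsScalarTower F B B] [SMulCommClass F B B] (t : F) :
    (evalAt t).comp (assocInvHom (F := F) (A := D) (B := B) (C := F[X])) =
      tmap (NonUnitalAlgHom.id F D) (evalAt t) := by
  ext x
  induction x with
  | zero => simp
  | add x y hx hy => rw [map_add, map_add, hx, hy]
  | tmul d y =>
    induction y with
    | zero => simp
    | add x y hx hy => rw [TensorProduct.tmul_add, map_add, map_add, hx, hy]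
    | tmul b p => simp

theorem tmap_evalAt_assocHom {D B : Type*}
    [NonUnitalRing D] [Module F D] [IsScalarTower F D D] [SMulCommClass F D D]
    [NonUnitalRing B] [Module F B] [IsScalarTower F B B] [SMulCommClass F B B] (t : F) :
    (tmap (NonUnitalAlgHom.id F D) (evalAt t)).comp
      (assocHom (F := F) (A := D) (B := B) (C := F[X])) = evalAt t := by
  rw [← evalAt_assocInvHom]
  ext x
  exact congrArg (evalAt t) ((TensorProduct.assoc F D B F[X]).symm_apply_apply x)

/-- Under `D ⊗ B[x] ≅ (D ⊗ B)[x]`, morphisms into `D ⊗ B[x]` are elementary homotopies. -/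
theorem elemHomotopic_tensor_iff {D B : NAlg F} {f g : A ⟶ (tensor.obj D).obj B} :
    ElemHomotopic (F := F) (A := A.carrier) (B := D.carrier ⊗[F] B.carrier) f g ↔
      ∃ H : A ⟶ (tensor.obj D).obj B.poly,
        H ≫ (tensor.obj D).map (B.ev 0) = f ∧ H ≫ (tensor.obj D).map (B.ev 1) = g := by
  constructor
  · rintro ⟨H, rfl, rfl⟩
    have h : ∀ t : F, (tmap (NonUnitalAlgHom.id F D.carrier) (evalAt t)).comp
        ((assocHom (F := F) (A := D.carrier) (B := B.carrier) (C := F[X])).comp H) =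
          (evalAt t).comp H := fun t =>
      congrArg (fun k => NonUnitalAlgHom.comp k H) (tmap_evalAt_assocHom t)
    exact ⟨(assocHom (F := F) (A := D.carrier) (B := B.carrier) (C := F[X])).comp H, h 0, h 1⟩
  · rintro ⟨H, rfl, rfl⟩
    have h : ∀ t : F, (evalAt t).comp
        ((assocInvHom (F := F) (A := D.carrier) (B := B.carrier) (C := F[X])).comp H) =
          (tmap (NonUnitalAlgHom.id F D.carrier) (evalAt t)).comp H := fun t =>
      congrArg (fun k => NonUnitalAlgHom.comp k H) (evalAt_assocInvHom t)
    exact ⟨(assocInvHom (F := F) (A := D.carrier) (B := B.carrier) (C := F[X])).comp H, h 0, h 1⟩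

/-- The kernel of `Hom(A, X ⊗ B) → [A, X ⊗ B]` is generated by elementary homotopies. -/
theorem mapFunctor_toHot_eq_iff {B : NAlg F} {x y : IndHom A ((indTensor X).obj B)} :
    IndHom.mapFunctor (toHot F) x = IndHom.mapFunctor (toHot F) y ↔
      Relation.ReflTransGen IndElemHomotopic x y := by
  constructor
  · obtain ⟨i, f, rfl⟩ := IndHom.exists_rep x
    obtain ⟨j, g, rfl⟩ := IndHom.exists_rep y
    intro h
    obtain ⟨k, h₁, h₂, e⟩ := IndHom.mk_eq_iff.1 h
    rw [← IndHom.mk_map h₁ f, ← IndHom.mk_map h₂ g]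
    have e' : (toHot F).map (f ≫ ((indTensor X).obj B).map (homOfLE h₁)) =
        (toHot F).map (g ≫ ((indTensor X).obj B).map (homOfLE h₂)) :=
      ((toHot F).map_comp _ _).trans (e.trans ((toHot F).map_comp _ _).symm)
    refine Relation.ReflTransGen.lift
      (fun f : A ⟶ ((indTensor X).obj B).obj k => IndHom.mk k f) ?_ _ _
      ((toHot_map_eq_iff _ _).1 e')
    intro a b hab
    obtain ⟨H, rfl, rfl⟩ := (elemHomotopic_tensor_iff (D := X.obj k) (B := B)).1 hab
    exact ⟨IndHom.mk (X := (indTensor X).obj B.poly) k H, rfl, rfl⟩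
  · intro h
    induction h with
    | refl => rfl
    | tail _ h ih =>
      refine ih.trans ?_
      obtain ⟨z, rfl, rfl⟩ := h
      obtain ⟨j, H, rfl⟩ := IndHom.exists_rep z
      refine congrArg (IndHom.mk (X := (indTensor X).obj B ⋙ toHot F) j)
        ((toHot_map_eq_iff _ _).2 (Relation.ReflTransGen.single ?_))
      exact (elemHomotopic_tensor_iff (D := X.obj j) (B := B)).2 ⟨H, rfl, rfl⟩

variable {P : Pro.{u + 1, u, u} (NAlg F)} (Φ : ProRepresentation A X P)

theorem proElemHomotopic_iff {B : NAlg F} {φ ψ : P ⟶ Pro.const.obj B} :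
    ProElemHomotopic φ ψ ↔ IndElemHomotopic (Φ.equiv B φ) (Φ.equiv B ψ) := by
  refine (Φ.equiv B.poly).exists_congr fun H => ?_
  rw [← Φ.natural, ← Φ.natural, Equiv.apply_eq_iff_eq, Equiv.apply_eq_iff_eq]

/-- A representation of `C ↦ Hom(A, X ⊗ C)` by a pro-algebra `P` respects homotopy, because it applies
to the morphisms into `B[x]`. -/
theorem proToHot_map_eq_iff_equiv {B : NAlg F} (φ ψ : P ⟶ Pro.const.obj B) :
    (proToHot F).map φ = (proToHot F).map ψ ↔
      IndHom.mapFunctor (toHot F) (Φ.equiv B φ) = IndHom.mapFunctor (toHot F) (Φ.equiv B ψ) := by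
  rw [proToHot_map_eq_iff, mapFunctor_toHot_eq_iff]
  refine ⟨Relation.ReflTransGen.lift (Φ.equiv B) (fun _ _ => (proElemHomotopic_iff Φ).1) _ _,
    fun h => ?_⟩
  have := Relation.ReflTransGen.lift (p := ProElemHomotopic) (Φ.equiv B).symm
    (fun x y hxy => (proElemHomotopic_iff Φ).2 (by simpa using hxy)) _ _ h
  rwa [Function.onFun, Equiv.symm_apply_apply, Equiv.symm_apply_apply] at this

end HomotopyClasses

/-! ### The cogroup structure on a representing pro-algebra -/

section Representing

variable {F : Type u} [Field F] {A : NAlg F}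

theorem QQ.map_eq_of_homotopic {B B' : NAlg F} {f g : B ⟶ B'} (h : homotopyRel F f g) :
    QQ.map (A := A) f = QQ.map g := by
  funext x
  obtain ⟨n, α, rfl⟩ := QQ.exists_rep x
  rw [QQ.map_cls, QQ.map_cls]
  refine QQ.cls_eq_of_homotopic (Homotopic.comp_right ?_ α)
  refine Relation.ReflTransGen.lift (fun f : B.carrier →ₙₐ[F] B'.carrier =>
    tmap (NonUnitalAlgHom.id F (Matrix (Fin n) (Fin n) F)) f) ?_ _ _ h
  rintro _ _ ⟨H, rfl, rfl⟩
  have key : ∀ t : F, (evalAt t).comp (assocInvHom.comp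
      (tmap (NonUnitalAlgHom.id F (Matrix (Fin n) (Fin n) F)) H)) =
        tmap (NonUnitalAlgHom.id F (Matrix (Fin n) (Fin n) F)) ((evalAt t).comp H) := fun t =>
    NonUnitalAlgHom.ext fun x =>
      (NonUnitalAlgHom.congr_fun (evalAt_assocInvHom t) _).trans (tmap_tmap F _ _ _ _ x)
  exact ⟨_, key 0, key 1⟩

/-- The functor `𝔔𝔔(A, -)` on the homotopy category of algebras. -/
def QQHotFunctor (A : NAlg F) : HotCat F ⥤ AddCommGrpCat.{u} :=
  CategoryTheory.Quotient.lift (homotopyRel F) (QQFunctor A) fun _ _ _ _ h =>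
    AddCommGrpCat.hom_ext (AddMonoidHom.ext (congrFun (QQ.map_eq_of_homotopic h)))

variable {P : ProAlg F} (Φ : ProRepresentation (cuntz A) (matSystem F) P)

theorem indClass_surjective (B : NAlg F) : Function.Surjective (indClass (A := A) (B := B)) := by
  intro x
  obtain ⟨n, α, rfl⟩ := QQ.exists_rep (A := A) (B := B) x
  exact ⟨IndHom.mk (A := cuntz A) (X := (indTensor (matSystem F)).obj B) n α, rfl⟩

theorem indClass_map {B B' : NAlg F} (f : B ⟶ B')
    (x : IndHom (cuntz A) ((indTensor (matSystem F)).obj B)) :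
    indClass (IndHom.map ((indTensor (matSystem F)).map f) x) =
      ((QQFunctor A).map f).hom (indClass x) := by
  obtain ⟨n, α, rfl⟩ := IndHom.exists_rep x
  rfl

theorem proToHot_map_surjective (P : ProAlg F) (B : NAlg F) : Function.Surjective
    fun φ : P ⟶ Pro.const.obj B => (proToHot F).map φ := by
  intro φ
  obtain ⟨i, f, rfl⟩ := Pro.exists_toConst (X := (proToHot F).obj P) (E := (toHot F).obj B) φ
  obtain ⟨f, rfl⟩ := (toHot F).map_surjective (X := P.obj i) (Y := B) f
  exact ⟨Pro.toConst P i f, rfl⟩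

/-- The bijection `[P, B] ≅ 𝔔𝔔(A, B)` induced by a representation. -/
def classesEquiv (E : HotCat F) :
    ((proToHot F).obj P ⟶ Pro.const.obj E) ≃ (QQHotFunctor A).obj E :=
  equivOfKernelEq (S := P ⟶ Pro.const.obj E.as) (p := fun φ => (proToHot F).map φ)
    (q := fun φ => indClass (Φ.equiv E.as φ)) (proToHot_map_surjective P E.as)
    ((indClass_surjective E.as).comp (Φ.equiv E.as).surjective) (proToHot_map_eq_iff_equiv Φ)

theorem classesEquiv_map {B : NAlg F} (φ : P ⟶ Pro.const.obj B) :
    classesEquiv Φ ((toHot F).obj B) ((proToHot F).map φ) = indClass (Φ.equiv B φ) :=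
  equivOfKernelEq_apply (S := P ⟶ Pro.const.obj B) _ _ _ φ

theorem classesEquiv_natural {E E' : HotCat F} (f : (proToHot F).obj P ⟶ Pro.const.obj E)
    (g : E ⟶ E') : classesEquiv Φ E' (f ≫ Pro.const.map g) =
      ((QQHotFunctor A).map g).hom (classesEquiv Φ E f) := by
  obtain ⟨B⟩ := E
  obtain ⟨B'⟩ := E'
  obtain ⟨φ, rfl⟩ := proToHot_map_surjective P B f
  obtain ⟨g, rfl⟩ := (toHot F).map_surjective (X := B) (Y := B') g
  refine Eq.trans ?_ (congrArg ((QQFunctor A).map g).hom (classesEquiv_map Φ φ)).symm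
  rw [← indClass_map, ← Φ.natural]
  refine Eq.trans (congrArg _ ?_) (classesEquiv_map Φ (φ ≫ Pro.const.map g))
  exact ((proToHot F).map_comp φ (Pro.const.map g)).symm

/-- The cocommutative cogroup structure on a representing pro-algebra. -/
def representingCogroup : CocommCogroup ((proToHot F).obj P) :=
  Pro.cogroup (classesEquiv Φ) (classesEquiv_natural Φ)

/-- The natural isomorphism `[P, -] ≅ 𝔔𝔔(A, -)` of functors to abelian groups. -/
def classesIso : classesFunctor (representingCogroup Φ) ≅ QQFunctor A :=
  NatIso.ofComponents
    (fun B => AddEquiv.toAddCommGrpIso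
      (X := (classesFunctor (representingCogroup Φ)).obj B) (Y := (QQFunctor A).obj B)
      (AddEquiv.mk' (classesEquiv Φ ((toHot F).obj B))
        (Pro.addHom_cogroup (classesEquiv Φ) (classesEquiv_natural Φ)
          (E := (toHot F).obj B))))
    fun {_ _} f => AddCommGrpCat.hom_ext (AddMonoidHom.ext fun x =>
      classesEquiv_natural Φ (E := (toHot F).obj _) (E' := (toHot F).obj _) x ((toHot F).map f))

theorem exists_proRepresentation (A : NAlg F) :
    ∃ P : ProAlg F, Nonempty (ProRepresentation (cuntz A) (matSystem F) P) :=
  ⟨_, ⟨corepProRepresentation.{u, u} (J := ℕ) fun n => tensorCorepresentableBy (cuntz A) _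
    (Matrix.stdBasis F (Fin n) (Fin n))⟩⟩

end Representing

end ClassifyingPro

end

open ClassifyingPro
theorem theorem2011272145 (F : Type*) [Field F] :
    (∀ A : NAlg F,
      (∃ P : ProAlg F, Nonempty (ProRepresentation (cuntz A) (matSystem F) P)) ∧
      ∀ (P : ProAlg F) (Φ : ProRepresentation (cuntz A) (matSystem F) P),
        ∃ (S : CocommCogroup ((proToHot F).obj P)) (e : classesFunctor S ≅ QQFunctor A),
          ∀ (B : NAlg F) (φ : P ⟶ Pro.const.obj B),
            (e.hom.app B).hom (proClass S φ) = indClass (Φ.equiv B φ)) ∧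
    ∃ (P : ProAlg F) (S : CocommCogroup ((proToHot F).obj P)),
      Nonempty (classesFunctor S ≅ QFunctor F) := by
  refine ⟨fun A => ⟨exists_proRepresentation A, fun P Φ =>
    ⟨representingCogroup Φ, classesIso Φ, fun B φ => classesEquiv_map Φ φ⟩⟩, ?_⟩
  obtain ⟨P, ⟨Φ⟩⟩ := exists_proRepresentation (baseField F)
  exact ⟨P, representingCogroup Φ, ⟨classesIso Φ⟩⟩
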